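/- Let $\omega_0,\epsilon_F>0$. For $T>0$ put $f(x)=1/(e^x+1)$, $n(x)=1/(e^x-1)$, $w(\epsilon)=f(\epsilon/T)[1-f(\epsilon/T)]$ and, for $\epsilon,u\in\mathbb R$, $$\bar K_0(\epsilon,u)=\Big[n\Big(\frac{u-\epsilon}{T}\Big)+f\Big(\frac uT\Big)\Big]\Big(\frac{u-\epsilon}{\omega_0}\Big)^2\operatorname{sgn}(u-\epsilon),$$ $$\bar K_1(\epsilon,u)=\frac{u-\epsilon}{2\epsilon_F}\,\bar K_0(\epsilon,u),\qquad \bar K_2(\epsilon,u)=\frac12\Big(\frac{u-\epsilon}{\omega_0}\Big)^2\bar K_0(\epsilon,u),$$ $\Gamma_0(\epsilon)=\int_{\mathbb R}\bar K_0(\epsilon,u)\,du$, $K=(\bar K_0+\bar K_1-\bar K_2)/\Gamma_0(\epsilon)$. Let $L^2_\sigma=L^2(\mathbb R,d\sigma)$ with $d\sigma(\epsilon)=w(\epsilon)\Gamma_0(\epsilon)\,d\epsilon$ (this space depends on $T$), and consider the integral equation $$\varphi(\epsilon)=\frac1{\Gamma_0(\epsilon)}+\int_{\mathbb R}K(\epsilon,u)\,\varphi(u)\,du\quad\text{for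 a.e. }\epsilon,\qquad \varphi\in L^2_\sigma. \tag{1}$$ Write $\varphi_\pm(\epsilon)=[\varphi(\epsilon)\pm\varphi(-\epsilon)]/2$. For a real $m$ and a function $\Phi$ on $\mathbb R$ that is not a.e. zero and such that $\epsilon\mapsto\Phi(\epsilon/T)$ lies in $L^2_\sigma$ for every $T>0$, say that a family $g=g_T$ has leading contribution $T^{m}\Phi(\epsilon/T)$ as $T\to0^+$ if $$\frac{\|g_T-T^{m}\Phi(\cdot/T)\|_{L^2_\sigma}}{\|T^{m}\Phi(\cdot/T)\|_{L^2_\sigma}}\longrightarrow0\qquad(T\to0^+).$$ Then for all sufficiently small $T>0$ equation (1) has a solution, unique up to a.e. equality. Moreover there are a constant $c$ and a function $\chi$, depending only on $\omega_0$ and $\epsilon_F$, such that for every family $\varphi=\varphi_T$ that solves (1) for all sufficiently small $T>0$: * the leading contribution to $\varphi_+$ as $T\to0^+$ is the constant function $c\,T^{-5}$ (in particular $c\neq0$); * the leading contribution to $\varphi_-$ as $T\to0^+$ is $T^{-4}\chi(\epsilon/T)$ (in particular $\chi$ is not a.e. zero); * whenever $\varphi_+$ and $\varphi_-$ have leading contributions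 $T^{-n_+}\Phi_+(\epsilon/T)$ and $T^{-n_-}\Phi_-(\epsilon/T)$, then $n_+=n_-+1=5$, and $\Phi_+=c$ a.e. -/

import Mathlib

open MeasureTheory Filter Topology

noncomputable section

namespace ElectronPhonon

/-- Fermi distribution function. -/
def fermi (x : ℝ) : ℝ := 1 / (Real.exp x + 1)

/-- Bose distribution function (its value at `0` is irrelevant below, where it only occurs
multiplied by a function that vanishes there). -/
def bose (x : ℝ) : ℝ := 1 / (Real.exp x - 1)

/-- The weight function `w(ε) = f₀(ε/T) [1 - f₀(ε/T)]` at temperature `T`. -/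
def weight (T ε : ℝ) : ℝ := fermi (ε / T) * (1 - fermi (ε / T))

/-- The spectrum of the effective potential for acoustic phonons, `(u/ω₀)² sgn u`. -/
def potential (ω₀ u : ℝ) : ℝ := (u / ω₀) ^ 2 * Real.sign u

/-- The kernel `K̄₀(ε,u) = [n((u-ε)/T) + f(u/T)] V̄₀''(u-ε)`. -/
def Kbar0 (ω₀ T ε u : ℝ) : ℝ :=
  (bose ((u - ε) / T) + fermi (u / T)) * potential ω₀ (u - ε)

/-- The kernel `K̄₁`. -/
def Kbar1 (ω₀ εF T ε u : ℝ) : ℝ :=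
  (ω₀ / (2 * εF)) * (T / ω₀) * ((u - ε) / T) * Kbar0 ω₀ T ε u

/-- The kernel `K̄₂`. -/
def Kbar2 (ω₀ T ε u : ℝ) : ℝ :=
  (1 / 2) * (T / ω₀) ^ 2 * ((u - ε) / T) ^ 2 * Kbar0 ω₀ T ε u

/-- The single-particle relaxation rate `Γ₀(ε) = ∫ K̄₀(ε,u) du`. -/
def Gamma0 (ω₀ T ε : ℝ) : ℝ := ∫ u, Kbar0 ω₀ T ε u

/-- The full kernel `K = K₀ + K₁ - K₂`, where `K_ν(ε,u) = K̄_ν(ε,u) / Γ₀(ε)`. -/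
def K (ω₀ εF T ε u : ℝ) : ℝ :=
  Kbar0 ω₀ T ε u / Gamma0 ω₀ T ε + Kbar1 ω₀ εF T ε u / Gamma0 ω₀ T ε
    - Kbar2 ω₀ T ε u / Gamma0 ω₀ T ε

/-- The measure `dσ(ε) = w(ε) Γ₀(ε) dε`; the Hilbert space `L²_σ` is `L²` of this measure. -/
def sigma (ω₀ T : ℝ) : Measure ℝ :=
  volume.withDensity fun ε => ENNReal.ofReal (weight T ε * Gamma0 ω₀ T ε)

/-- `φ` is a solution in `L²_σ`, at temperature `T`, of the integral equation
`φ(ε) = 1/Γ₀(ε) + ∫ K(ε,u) φ(u) du`. -/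
structure IsSolution (ω₀ εF T : ℝ) (φ : ℝ → ℝ) : Prop where
  memLp : MemLp φ 2 (sigma ω₀ T)
  integrable : ∀ᵐ ε, Integrable fun u => K ω₀ εF T ε u * φ u
  equation : ∀ᵐ ε, φ ε = 1 / Gamma0 ω₀ T ε + ∫ u, K ω₀ εF T ε u * φ u

/-- The even part `φ₊`. -/
def evenPart (φ : ℝ → ℝ) (ε : ℝ) : ℝ := (φ ε + φ (-ε)) / 2

/-- The odd part `φ₋`. -/
def oddPart (φ : ℝ → ℝ) (ε : ℝ) : ℝ := (φ ε - φ (-ε)) / 2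

/-- For `T → 0⁺` the leading contribution to the family `f` (of functions of the energy, indexed
by the temperature) is `T ^ n Φ(ε/T)`, with `Φ` not the null function: the norm in `L²_σ` of
the difference is small compared with that of the leading contribution. In particular
the leading contribution scales as `T ^ n`. -/
structure HasLeadingTerm (ω₀ : ℝ) (f : ℝ → ℝ → ℝ) (n : ℝ) (Φ : ℝ → ℝ) : Prop where
  memLp : ∀ T : ℝ, 0 < T → MemLp (fun ε => T ^ n * Φ (ε / T)) 2 (sigma ω₀ T)
  not_null : ¬ Φ =ᵐ[volume] 0
  tendsto : Tendsto
    (fun T : ℝ => eLpNorm (fun ε => f T ε - T ^ n * Φ (ε / T)) 2 (sigma ω₀ T) /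
      eLpNorm (fun ε => T ^ n * Φ (ε / T)) 2 (sigma ω₀ T))
    (𝓝[>] 0) (𝓝 0)

end ElectronPhonon

end

/-!
Substitute `ε = T x` and multiply (1) by the square root of the density of `σ`. The unknown is then
in a fixed space `L²(ℝ)`, and (1) becomes `(A - T B + T² D) u = (ω₀² / T³) b`. Here `A = 1 - K₀` is
symmetric by detailed balance, `D` is symmetric and `B` is antisymmetric. The form of `A` is
nonnegative and vanishes on the function `e` that represents the constants (particle conservation).
It has a spectral gap above `ℝ e`: on a compact set of energies by a Poincaré inequality for the
jump process, and at high energies because the relaxation rate grows without bound.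

As `B` does not contribute to the form and `⟪D e, e⟫ > 0`, the form of `A - T B + T² D` controls
`‖u - m e‖² + T² m²` for a suitable `m`. Hence the operator is bijective for small `T` by
Lax–Milgram, and the same bound yields `T⁵ u = (c + O(T)) e + T χ + O(T²)` with `A χ = c B e`, where
`c ≠ 0` follows from the solvability condition at the next order. Reflection commutes with `A` and
anticommutes with `B`, so `e` is even and the odd part of `T⁵ u` is `T` times the odd part of `χ` to
leading order. This is not zero since `B e ≠ 0`: the mean energy change in a collision is directed
towards the Fermi level.
-/

section SingularPerturbation

open RealInnerProductSpace

theorem tendsto_of_norm_sub_le_mul {E : Type*} [SeminormedAddCommGroup E] {v : ℝ → E} {x : E}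
    {C : ℝ} (h : ∀ᶠ t in 𝓝[>] (0 : ℝ), ‖v t - x‖ ≤ C * t) : Tendsto v (𝓝[>] 0) (𝓝 x) := by
  rw [tendsto_iff_norm_sub_tendsto_zero]
  refine squeeze_zero' (Eventually.of_forall fun _ => norm_nonneg _) h ?_
  exact (continuous_const_mul C).tendsto' 0 0 (mul_zero C) |>.mono_left nhdsWithin_le_nhds

section EvenOdd

variable {E : Type*} [SeminormedAddCommGroup E] [NormedSpace ℝ E]

theorem norm_half_smul_add_le {v w : E} (h : ‖w‖ = ‖v‖) : ‖(2⁻¹ : ℝ) • (v + w)‖ ≤ ‖v‖ := by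
  grw [norm_smul, norm_add_le, h, Real.norm_of_nonneg (by norm_num)]
  linarith

variable {u : ℝ → E} {e χ : E} {c C : ℝ} {J : E →ₗᵢ[ℝ] E}

theorem tendsto_half_smul_add (hJe : J e = e)
    (h : ∀ᶠ t in 𝓝[>] (0 : ℝ), ∃ m : ℝ, |m| ≤ C * t ∧
      ‖u t - (c + m) • e - t • χ‖ ≤ C * t ^ 2) :
    Tendsto (fun t => (2⁻¹ : ℝ) • (u t + J (u t))) (𝓝[>] 0) (𝓝 (c • e)) := by
  refine tendsto_of_norm_sub_le_mul (C := C + C * ‖e‖ + ‖χ‖) ?_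
  filter_upwards [h, Ioo_mem_nhdsGT one_pos] with t ⟨m, hm, hum⟩ ht
  have ht0 := ht.1
  have hC : 0 ≤ C := nonneg_of_mul_nonneg_left ((abs_nonneg m).trans hm) ht0
  calc ‖(2⁻¹ : ℝ) • (u t + J (u t)) - c • e‖
      = ‖(2⁻¹ : ℝ) • ((u t - c • e) + J (u t - c • e))‖ := by
        rw [map_sub, map_smul, hJe]; congr 1; module
    _ ≤ ‖u t - c • e‖ := norm_half_smul_add_le (J.norm_map _)
    _ = ‖(u t - (c + m) • e - t • χ) + (m • e + t • χ)‖ := by congr 1; module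
    _ ≤ C * t ^ 2 + (C * t * ‖e‖ + t * ‖χ‖) := by
      grw [norm_add_le, norm_add_le, hum, norm_smul, norm_smul, Real.norm_eq_abs, hm,
        Real.norm_of_nonneg ht0.le]
    _ ≤ (C + C * ‖e‖ + ‖χ‖) * t := by
      nlinarith [mul_nonneg hC (mul_nonneg ht0.le (sub_nonneg.mpr ht.2.le))]

theorem tendsto_inv_smul_half_smul_sub (hJe : J e = e)
    (h : ∀ᶠ t in 𝓝[>] (0 : ℝ), ∃ k : ℝ, ‖u t - k • e - t • χ‖ ≤ C * t ^ 2) :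
    Tendsto (fun t => t⁻¹ • (2⁻¹ : ℝ) • (u t - J (u t))) (𝓝[>] 0)
      (𝓝 ((2⁻¹ : ℝ) • (χ - J χ))) := by
  refine tendsto_of_norm_sub_le_mul (C := C) ?_
  filter_upwards [h, self_mem_nhdsWithin] with t ⟨k, huk⟩ (ht : 0 < t)
  calc ‖t⁻¹ • (2⁻¹ : ℝ) • (u t - J (u t)) - (2⁻¹ : ℝ) • (χ - J χ)‖
      = ‖t⁻¹ • (2⁻¹ : ℝ) • ((u t - k • e - t • χ) + -J (u t - k • e - t • χ))‖ := by
        congr 1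
        simp only [map_sub, map_smul, hJe]
        match_scalars <;> field_simp
        ring
    _ ≤ t⁻¹ * (C * t ^ 2) := by
      rw [norm_smul, Real.norm_of_nonneg (inv_pos.mpr ht).le]
      grw [norm_half_smul_add_le (by rw [norm_neg, J.norm_map]), huk]
    _ = C * t := by field_simp

end EvenOdd

variable {H : Type*} [NormedAddCommGroup H] [InnerProductSpace ℝ H]

theorem inner_self_eq_zero_of_skew {B : H → H} (hB : ∀ u v, ⟪B u, v⟫ = -⟪u, B v⟫) (u : H) :
    ⟪B u, u⟫ = 0 := by
  linarith [hB u u, real_inner_comm u (B u)]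

/-- The form of `A` has a spectral gap above the line spanned by `e`. -/
def HasGapAbove (A : H →L[ℝ] H) (e : H) : Prop :=
  ∃ κ > 0, ∀ u, ∃ m : ℝ, κ * ‖u - m • e‖ ^ 2 ≤ ⟪A u, u⟫

/-- The singularly perturbed operator `A - t B + t² D`; in the application `t` is the temperature
and the three coefficients come from the kernels `K̄₀`, `K̄₁`, `K̄₂`. -/
def quadraticPencil (A B D : H →L[ℝ] H) (t : ℝ) : H →L[ℝ] H := A - t • B + t ^ 2 • D

variable {A B D : H →L[ℝ] H} {e : H}

theorem quadraticPencil_apply (A B D : H →L[ℝ] H) (t : ℝ) (u : H) :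
    quadraticPencil A B D t u = A u - t • B u + t ^ 2 • D u := rfl

theorem inner_quadraticPencil_self (hB : ∀ u, ⟪B u, u⟫ = 0) (t : ℝ) (u : H) :
    ⟪quadraticPencil A B D t u, u⟫ = ⟪A u, u⟫ + t ^ 2 * ⟪D u, u⟫ := by
  simp only [quadraticPencil_apply, inner_add_left, inner_sub_left, real_inner_smul_left, hB,
    mul_zero, sub_zero]

theorem HasGapAbove.inner_self_nonneg (hA : HasGapAbove A e) (u : H) : 0 ≤ ⟪A u, u⟫ := by
  obtain ⟨κ, hκ, h⟩ := hA
  obtain ⟨m, hm⟩ := h u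
  exact le_trans (by positivity) hm

theorem exists_sub_le_inner_add_smul (D : H →L[ℝ] H) {e : H} (hD : 0 < ⟪D e, e⟫) :
    ∃ d > 0, ∃ L, ∀ (v : H) (m : ℝ),
      d * m ^ 2 - L * ‖v‖ ^ 2 ≤ ⟪D (v + m • e), v + m • e⟫ := by
  have bound (x y : H) : |⟪D x, y⟫| ≤ ‖D‖ * ‖x‖ * ‖y‖ :=
    (abs_real_inner_le_norm _ _).trans (by gcongr; exact D.le_opNorm x)
  set d := ⟪D e, e⟫
  set M := ‖D‖ * ‖e‖
  refine ⟨d / 2, by positivity, 2 * M ^ 2 / d + ‖D‖, fun v m => ?_⟩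
  have expansion : ⟪D (v + m • e), v + m • e⟫
      = ⟪D v, v⟫ + m * (⟪D e, v⟫ + ⟪D v, e⟫) + d * m ^ 2 := by
    simp only [map_add, map_smul, inner_add_left, inner_add_right, real_inner_smul_left,
      real_inner_smul_right]
    ring
  have cross : -(|m| * (2 * M * ‖v‖)) ≤ m * (⟪D e, v⟫ + ⟪D v, e⟫) := by
    refine neg_le_of_abs_le ?_
    rw [abs_mul]
    gcongr
    linarith [abs_add_le ⟪D e, v⟫ ⟪D v, e⟫, bound e v, bound v e]
  have amgm : |m| * (2 * M * ‖v‖) ≤ d / 2 * m ^ 2 + 2 * M ^ 2 / d * ‖v‖ ^ 2 := by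
    rw [← sq_abs m, ← sub_nonneg]
    calc 0 ≤ (d * |m| - 2 * M * ‖v‖) ^ 2 / (2 * d) := by positivity
      _ = _ := by field_simp; ring
  have diagonal : -(‖D‖ * ‖v‖ ^ 2) ≤ ⟪D v, v⟫ :=
    neg_le_of_abs_le ((bound v v).trans_eq (by ring))
  rw [expansion]
  linarith

theorem HasGapAbove.exists_coercive (hA : HasGapAbove A e) (hB : ∀ u, ⟪B u, u⟫ = 0)
    (hD : 0 < ⟪D e, e⟫) :
    ∃ k > 0, ∀ᶠ t in 𝓝[>] (0 : ℝ), ∀ u, ∃ m : ℝ,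
      k * (‖u - m • e‖ ^ 2 + t ^ 2 * m ^ 2) ≤ ⟪quadraticPencil A B D t u, u⟫ := by
  obtain ⟨κ, hκ, gap⟩ := hA
  obtain ⟨d, hd, L, hL⟩ := exists_sub_le_inner_add_smul D hD
  refine ⟨min (κ / 2) d, by positivity, ?_⟩
  have small : ∀ᶠ t in 𝓝[>] (0 : ℝ), t ^ 2 * L ≤ κ / 2 :=
    (((continuous_id.pow 2).mul continuous_const).tendsto' 0 0 (by simp)).mono_left
      nhdsWithin_le_nhds |>.eventually_le_const (half_pos hκ)
  filter_upwards [small] with t ht u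
  obtain ⟨m, hm⟩ := gap u
  refine ⟨m, ?_⟩
  have form := hL (u - m • e) m
  rw [sub_add_cancel] at form
  rw [inner_quadraticPencil_self hB]
  set V := ‖u - m • e‖ ^ 2
  calc min (κ / 2) d * (V + t ^ 2 * m ^ 2)
      = min (κ / 2) d * V + min (κ / 2) d * (t ^ 2 * m ^ 2) := mul_add _ _ _
    _ ≤ (κ - t ^ 2 * L) * V + d * (t ^ 2 * m ^ 2) := by
        gcongr
        · linarith [min_le_left (κ / 2) d]
        · exact min_le_right _ _
    _ = κ * V + t ^ 2 * (d * m ^ 2 - L * V) := by ring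
    _ ≤ _ := by gcongr

theorem norm_sq_le_mul_add (e u : H) (m : ℝ) {t : ℝ} (ht : 0 < t) :
    ‖u‖ ^ 2 ≤ (1 + ‖e‖ ^ 2 / t ^ 2) * (‖u - m • e‖ ^ 2 + t ^ 2 * m ^ 2) := by
  have triangle : ‖u‖ ≤ ‖u - m • e‖ + |m| * ‖e‖ := by
    simpa only [sub_add_cancel, norm_smul, Real.norm_eq_abs] using norm_add_le (u - m • e) (m • e)
  calc ‖u‖ ^ 2 ≤ (‖u - m • e‖ + |m| * ‖e‖) ^ 2 := by gcongr
    _ ≤ (‖u - m • e‖ + |m| * ‖e‖) ^ 2 + (t * |m| - ‖e‖ / t * ‖u - m • e‖) ^ 2 :=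
        le_add_of_nonneg_right (sq_nonneg _)
    _ = (1 + ‖e‖ ^ 2 / t ^ 2) * (‖u - m • e‖ ^ 2 + t ^ 2 * |m| ^ 2) := by field_simp; ring
    _ = _ := by rw [sq_abs]

theorem le_mul_of_quadratic_le {k R E t V m : ℝ} (hk : 0 < k) (hR : 0 ≤ R) (hE : 0 ≤ E)
    (ht : 0 < t) (ht1 : t ≤ 1) (hV : 0 ≤ V)
    (h : k * (V ^ 2 + t ^ 2 * m ^ 2) ≤ t ^ 3 * (R * (V + |m| * E))) :
    |m| ≤ 2 * (1 + E) / k * R * t ∧ V ≤ 2 * (1 + E) / k * R * t ^ 2 := by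
  obtain ⟨X, hX, rfl⟩ : ∃ X, 0 ≤ X ∧ V = t * X := ⟨V / t, by positivity, by field_simp⟩
  have hm := abs_nonneg m
  rw [← sq_abs m] at h
  suffices hXm : X + |m| ≤ 2 * (1 + E) / k * R * t by
    exact ⟨by linarith, by nlinarith⟩
  obtain h0 | hpos := (add_nonneg hX hm).eq_or_lt
  · rw [← h0]; positivity
  have scaled : k * (X ^ 2 + |m| ^ 2) ≤ R * t * (t * X + |m| * E) :=
    le_of_mul_le_mul_left (by linarith) (pow_pos ht 2)
  have linear : t * X + |m| * E ≤ (1 + E) * (X + |m|) := by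
    linarith [mul_le_of_le_one_left hX ht1, mul_nonneg hX hE]
  rw [div_mul_eq_mul_div, div_mul_eq_mul_div, le_div_iff₀ hk]
  refine le_of_mul_le_mul_right ?_ hpos
  calc (X + |m|) * k * (X + |m|) ≤ 2 * (k * (X ^ 2 + |m| ^ 2)) := by
        nlinarith [mul_nonneg hk.le (sq_nonneg (X - |m|))]
    _ ≤ 2 * (R * t * ((1 + E) * (X + |m|))) := by
        grw [scaled, linear]
    _ = _ := by ring

theorem HasGapAbove.exists_estimate (hA : HasGapAbove A e) (hB : ∀ u, ⟪B u, u⟫ = 0)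
    (hD : 0 < ⟪D e, e⟫) :
    ∃ C ≥ 0, ∀ᶠ t in 𝓝[>] (0 : ℝ), ∀ w r, quadraticPencil A B D t w = t ^ 3 • r →
      ∃ m : ℝ, |m| ≤ C * ‖r‖ * t ∧ ‖w - m • e‖ ≤ C * ‖r‖ * t ^ 2 := by
  obtain ⟨k, hk, coercive⟩ := hA.exists_coercive hB hD
  refine ⟨2 * (1 + ‖e‖) / k, by positivity, ?_⟩
  filter_upwards [coercive, Ioo_mem_nhdsGT one_pos] with t hco ht w r hw
  obtain ⟨m, hm⟩ := hco w
  refine ⟨m, le_mul_of_quadratic_le hk (norm_nonneg r) (norm_nonneg e) ht.1 ht.2.le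
    (norm_nonneg _) (hm.trans ?_)⟩
  have triangle : ‖w‖ ≤ ‖w - m • e‖ + |m| * ‖e‖ := by
    simpa only [sub_add_cancel, norm_smul, Real.norm_eq_abs] using norm_add_le (w - m • e) (m • e)
  rw [hw, real_inner_smul_left]
  have := ht.1
  gcongr
  exact (real_inner_le_norm r w).trans (by gcongr)

variable [CompleteSpace H]

theorem bijective_of_coercive {L : H →L[ℝ] H} {k : ℝ} (hk : 0 < k)
    (h : ∀ u, k * ‖u‖ ^ 2 ≤ ⟪L u, u⟫) : Function.Bijective L := by
  have coercive : IsCoercive ((innerSL ℝ : H →L[ℝ] H →L[ℝ] ℝ) ∘L L) :=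
    ⟨k, hk, fun u => by rw [mul_assoc, ← sq]; exact h u⟩
  have hL : ⇑L = coercive.continuousLinearEquivOfBilin :=
    funext fun _ => coercive.unique_continuousLinearEquivOfBilin fun _ => rfl
  rw [hL]
  exact coercive.continuousLinearEquivOfBilin.bijective

theorem HasGapAbove.eventually_bijective (hA : HasGapAbove A e) (hB : ∀ u, ⟪B u, u⟫ = 0)
    (hD : 0 < ⟪D e, e⟫) :
    ∀ᶠ t in 𝓝[>] (0 : ℝ), Function.Bijective (quadraticPencil A B D t) := by
  obtain ⟨k, hk, coercive⟩ := hA.exists_coercive hB hD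
  filter_upwards [coercive, self_mem_nhdsWithin] with t hco (ht : 0 < t)
  refine bijective_of_coercive (k := k / (1 + ‖e‖ ^ 2 / t ^ 2)) (by positivity) fun u => ?_
  obtain ⟨m, hm⟩ := hco u
  refine le_trans ?_ hm
  rw [div_mul_eq_mul_div, div_le_iff₀ (by positivity), mul_assoc k, mul_comm (_ + _) (1 + _)]
  gcongr
  exact norm_sq_le_mul_add e u m ht

theorem HasGapAbove.exists_apply_eq (hA : HasGapAbove A e) (hsymm : ∀ u v, ⟪A u, v⟫ = ⟪u, A v⟫)
    (hAe : A e = 0) (he : e ≠ 0) {r : H} (hr : ⟪e, r⟫ = 0) : ∃ χ, A χ = r := by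
  -- the rank-one perturbation by the projection onto `e` does not change `A` on `eᗮ`
  set P : H →L[ℝ] H := (innerSL ℝ e).smulRight e
  have hP (u : H) : P u = ⟪e, u⟫ • e := rfl
  have hee : 0 < ⟪e, e⟫ := real_inner_self_pos.mpr he
  have hPe : 0 < ⟪P e, e⟫ := by
    rw [hP, real_inner_smul_left]
    exact mul_pos hee hee
  obtain ⟨t, hbij, ht : 0 < t⟩ := ((hA.eventually_bijective (B := 0) (fun u => inner_zero_left u)
    hPe).and self_mem_nhdsWithin).exists
  obtain ⟨χ, hχ⟩ := hbij.2 r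
  simp only [quadraticPencil_apply, zero_apply, smul_zero, sub_zero, hP] at hχ
  have orthogonal : ⟪e, χ⟫ = 0 := by
    have := congrArg (fun x => ⟪e, x⟫) hχ
    simpa [inner_add_right, real_inner_smul_right, hr, ← hsymm, hAe, ht.ne', he] using this
  exact ⟨χ, by simpa [orthogonal] using hχ⟩

/-- `c e + t χ + t² ξ` solves `quadraticPencil A B D t u = t ^ 2 • b` up to `O(t³)`; the number `c`
is fixed by the solvability condition for `ξ`. -/
theorem HasGapAbove.exists_formal_solution (hA : HasGapAbove A e)
    (hsymm : ∀ u v, ⟪A u, v⟫ = ⟪u, A v⟫) (hAe : A e = 0) (hB : ∀ u v, ⟪B u, v⟫ = -⟪u, B v⟫)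
    (hD : 0 < ⟪D e, e⟫) {b : H} (hb : ⟪e, b⟫ ≠ 0) :
    ∃ (c : ℝ) (χ ξ : H), c ≠ 0 ∧ A χ = c • B e ∧ A ξ = b + B χ - c • D e := by
  have he : e ≠ 0 := by
    rintro rfl
    simp at hb
  obtain ⟨χ, hχ⟩ := hA.exists_apply_eq hsymm hAe he
    ((real_inner_comm _ _).trans (inner_self_eq_zero_of_skew hB e))
  have hpos : 0 < ⟪B e, χ⟫ + ⟪D e, e⟫ :=
    add_pos_of_nonneg_of_pos (hχ ▸ hA.inner_self_nonneg χ) hD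
  set c := ⟪e, b⟫ / (⟪B e, χ⟫ + ⟪D e, e⟫)
  have solvable : ⟪e, b + B (c • χ) - c • D e⟫ = 0 := by
    have hcb : c * (⟪B e, χ⟫ + ⟪D e, e⟫) = ⟪e, b⟫ := div_mul_cancel₀ _ hpos.ne'
    rw [inner_sub_right, inner_add_right, map_smul, real_inner_smul_right, real_inner_smul_right,
      ← hcb, hB e χ, real_inner_comm (D e) e]
    ring
  obtain ⟨ξ, hξ⟩ := hA.exists_apply_eq hsymm hAe he solvable
  exact ⟨c, c • χ, ξ, div_ne_zero hb hpos.ne', by rw [map_smul, hχ], hξ⟩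

theorem HasGapAbove.exists_expansion (hA : HasGapAbove A e)
    (hsymm : ∀ u v, ⟪A u, v⟫ = ⟪u, A v⟫) (hAe : A e = 0) (hB : ∀ u v, ⟪B u, v⟫ = -⟪u, B v⟫)
    (hD : 0 < ⟪D e, e⟫) {b : H} (hb : ⟪e, b⟫ ≠ 0) :
    ∃ (c : ℝ) (χ : H) (C : ℝ), c ≠ 0 ∧ A χ = c • B e ∧
      ∀ᶠ t in 𝓝[>] (0 : ℝ), ∀ u, quadraticPencil A B D t u = t ^ 2 • b →
        ∃ m : ℝ, |m| ≤ C * t ∧ ‖u - (c + m) • e - t • χ‖ ≤ C * t ^ 2 := by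
  obtain ⟨c, χ, ξ, hc, hχ, hξ⟩ := hA.exists_formal_solution hsymm hAe hB hD hb
  obtain ⟨C, hC, estimate⟩ := hA.exists_estimate (inner_self_eq_zero_of_skew hB) hD
  set R := ‖B ξ‖ + ‖D χ‖ + ‖D ξ‖
  have : 0 ≤ R := by positivity
  refine ⟨c, χ, C * R + ‖ξ‖, hc, hχ, ?_⟩
  filter_upwards [estimate, Ioo_mem_nhdsGT one_pos] with t hest ht u hu
  have ht0 := ht.1
  set r := B ξ - D χ - t • D ξ
  set w := u - c • e - t • χ - t ^ 2 • ξ with hw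
  have residual : quadraticPencil A B D t w = t ^ 3 • r := by
    have huw : u = w + c • e + t • χ + t ^ 2 • ξ := by rw [hw]; module
    rw [huw] at hu
    simp only [quadraticPencil_apply, map_add, map_smul, hAe, hχ, hξ] at hu ⊢
    linear_combination (norm := module) hu
  have hr : ‖r‖ ≤ R := by
    grw [norm_sub_le, norm_sub_le, norm_smul, Real.norm_of_nonneg ht0.le, ht.2.le, one_mul]
  obtain ⟨m, hm, hwm⟩ := hest w r residual
  refine ⟨m, ?_, ?_⟩
  · calc |m| ≤ C * R * t := hm.trans (by gcongr)
      _ ≤ _ := by gcongr; linarith [norm_nonneg ξ]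
  · calc ‖u - (c + m) • e - t • χ‖ = ‖(w - m • e) + t ^ 2 • ξ‖ := by rw [hw]; congr 1; module
      _ ≤ C * R * t ^ 2 + t ^ 2 * ‖ξ‖ := by
        grw [norm_add_le, hwm, hr, norm_smul, Real.norm_of_nonneg (sq_nonneg t)]
      _ = _ := by ring

theorem HasGapAbove.exists_tendsto (hA : HasGapAbove A e)
    (hsymm : ∀ u v, ⟪A u, v⟫ = ⟪u, A v⟫) (hAe : A e = 0) (hB : ∀ u v, ⟪B u, v⟫ = -⟪u, B v⟫)
    (hBe : B e ≠ 0) (hD : 0 < ⟪D e, e⟫) {b : H} (hb : ⟪e, b⟫ ≠ 0) (J : H →ₗᵢ[ℝ] H) (hJe : J e = e)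
    (hJA : ∀ u, J (A u) = A (J u)) (hJB : ∀ u, J (B u) = -B (J u)) :
    ∃ (c : ℝ) (χ : H), c ≠ 0 ∧ χ ≠ 0 ∧ ∀ u : ℝ → H,
      (∀ᶠ t in 𝓝[>] (0 : ℝ), quadraticPencil A B D t (u t) = t ^ 2 • b) →
        Tendsto (fun t => (2⁻¹ : ℝ) • (u t + J (u t))) (𝓝[>] 0) (𝓝 (c • e)) ∧
        Tendsto (fun t => t⁻¹ • (2⁻¹ : ℝ) • (u t - J (u t))) (𝓝[>] 0) (𝓝 χ) := by
  obtain ⟨c, χ, C, hc, hχ, expansion⟩ := hA.exists_expansion hsymm hAe hB hD hb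
  have hAχ : A ((2⁻¹ : ℝ) • (χ - J χ)) = c • B e := by
    rw [map_smul, map_sub, ← hJA, hχ, map_smul, hJB, hJe]
    module
  refine ⟨c, (2⁻¹ : ℝ) • (χ - J χ), hc, fun h => smul_ne_zero hc hBe ?_, fun u hu => ?_⟩
  · rw [← hAχ, h, map_zero]
  · have hu_expansion := expansion.and hu |>.mono fun t h => h.1 (u t) h.2
    exact ⟨tendsto_half_smul_add hJe hu_expansion, tendsto_inv_smul_half_smul_sub hJe
      (hu_expansion.mono fun t ⟨m, _, hum⟩ => ⟨c + m, hum⟩)⟩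

end SingularPerturbation

section ConvolutionDominatedKernels

open RealInnerProductSpace

section WeightedCauchySchwarz

variable {α : Type*} [MeasurableSpace α] {μ : Measure α} {k f : α → ℝ}

theorem integrable_mul_of_integrable_mul_sq (hk : ∀ x, 0 ≤ k x) (hki : Integrable k μ)
    (hf : AEStronglyMeasurable f μ) (hkf : Integrable (fun x => k x * f x ^ 2) μ) :
    Integrable (fun x => k x * f x) μ := by
  refine (hki.add hkf).mono' (hki.1.mul hf) (Eventually.of_forall fun x => ?_)
  rw [Real.norm_eq_abs, abs_mul, abs_of_nonneg (hk x), Pi.add_apply, ← sq_abs (f x)]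
  nlinarith [hk x, sq_nonneg (|f x| - 1), abs_nonneg (f x)]

theorem sq_integral_mul_le (hk : ∀ x, 0 ≤ k x) (hki : Integrable k μ)
    (hf : AEStronglyMeasurable f μ) (hkf : Integrable (fun x => k x * f x ^ 2) μ) :
    (∫ x, k x * f x ∂μ) ^ 2 ≤ (∫ x, k x ∂μ) * ∫ x, k x * f x ^ 2 ∂μ := by
  have hkf1 := integrable_mul_of_integrable_mul_sq hk hki hf hkf
  have quadratic (t : ℝ) : ∫ x, k x * (t - f x) ^ 2 ∂μ
      = (∫ x, k x ∂μ) * (t * t) + (-2 * ∫ x, k x * f x ∂μ) * t + ∫ x, k x * f x ^ 2 ∂μ := by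
    have (x : α) : k x * (t - f x) ^ 2
        = t * t * k x + -2 * t * (k x * f x) + k x * f x ^ 2 := by ring
    simp_rw [this]
    rw [integral_add ((hki.const_mul _).fun_add (hkf1.const_mul _)) hkf,
      integral_add (hki.const_mul _) (hkf1.const_mul _), integral_const_mul, integral_const_mul]
    ring
  have discriminant : discrim (∫ x, k x ∂μ) (-2 * ∫ x, k x * f x ∂μ)
      (∫ x, k x * f x ^ 2 ∂μ) ≤ 0 := discrim_le_zero fun t =>
    (integral_nonneg fun x => mul_nonneg (hk x) (sq_nonneg _)).trans_eq (quadratic t)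
  rw [discrim] at discriminant
  linarith

theorem norm_sq_eq_integral_sq (u : α →₂[μ] ℝ) : ‖u‖ ^ 2 = ∫ x, u x ^ 2 ∂μ := by
  rw [← real_inner_self_eq_norm_sq, L2.inner_def]
  simp only [real_inner_self_eq_norm_sq, Real.norm_eq_abs, sq_abs]

end WeightedCauchySchwarz

section Reflection

variable {G : Type*} [MeasurableSpace G] [AddGroup G] [MeasurableNeg G] (μ : Measure G)
  [μ.IsNegInvariant]

/-- The reflection `u ↦ u(-·)` of `L²(μ)`. -/
noncomputable def reflection : (G →₂[μ] ℝ) →ₗᵢ[ℝ] G →₂[μ] ℝ :=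
  Lp.compMeasurePreservingₗᵢ ℝ (fun x : G => -x) (Measure.measurePreserving_neg μ)

variable {μ}

theorem coeFn_reflection (u : G →₂[μ] ℝ) : reflection μ u =ᵐ[μ] fun x => u (-x) :=
  Lp.coeFn_compMeasurePreserving u (Measure.measurePreserving_neg μ)

theorem ae_neg {p : G → Prop} (h : ∀ᵐ x ∂μ, p x) : ∀ᵐ x ∂μ, p (-x) :=
  (Measure.measurePreserving_neg μ).quasiMeasurePreserving.ae h

end Reflection

variable {G : Type*} [MeasurableSpace G] [AddCommGroup G] {μ : Measure G} {κ : G → ℝ}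
  {s : G → G → ℝ}

/-- `s` is a measurable kernel dominated by the convolution kernel of the integrable function
`κ`, so that it defines a bounded operator on `L²(μ)`. -/
structure ConvDominated (μ : Measure G) (κ : G → ℝ) (s : G → G → ℝ) : Prop where
  integrable : Integrable κ μ
  measurable : Measurable (Function.uncurry s)
  bound : ∀ x y, |s x y| ≤ κ (y - x)

theorem ConvDominated.nonneg (hs : ConvDominated μ κ s) (z : G) : 0 ≤ κ z := by
  simpa only [sub_zero] using (abs_nonneg _).trans (hs.bound 0 z)

variable [MeasurableAdd₂ G] [MeasurableNeg G] [SFinite μ] [μ.IsAddLeftInvariant]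
  [μ.IsNegInvariant]

theorem integrable_conv_mul_snd {f : G → ℝ} (hκ : Integrable κ μ) (hf : Integrable f μ) :
    Integrable (fun p : G × G => κ (p.2 - p.1) * f p.2) (μ.prod μ) := by
  refine (hf.convolution_integrand (ContinuousLinearMap.mul ℝ ℝ) hκ.comp_neg).congr
    (Eventually.of_forall fun p => ?_)
  simp only [neg_sub, ContinuousLinearMap.mul_apply', mul_comm]

theorem integrable_conv_mul_fst {f : G → ℝ} (hκ : Integrable κ μ) (hf : Integrable f μ) :
    Integrable (fun p : G × G => κ (p.2 - p.1) * f p.1) (μ.prod μ) := by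
  refine (integrable_conv_mul_snd hκ.comp_neg hf).swap.congr (Eventually.of_forall fun p => ?_)
  simp only [Function.comp_apply, Prod.fst_swap, Prod.snd_swap, neg_sub]

namespace ConvDominated

theorem integrable_prod (hs : ConvDominated μ κ s) {u v : G → ℝ} (hu : MemLp u 2 μ)
    (hv : MemLp v 2 μ) :
    Integrable (fun p : G × G => s p.1 p.2 * u p.2 * v p.1) (μ.prod μ) := by
  refine ((integrable_conv_mul_snd hs.integrable hu.integrable_sq).add
    (integrable_conv_mul_fst hs.integrable hv.integrable_sq)).mono'
    ((hs.measurable.aestronglyMeasurable.mul hu.1.comp_snd).mul hv.1.comp_fst)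
    (Eventually.of_forall fun p => ?_)
  calc ‖s p.1 p.2 * u p.2 * v p.1‖ = |s p.1 p.2| * (|u p.2| * |v p.1|) := by
        rw [Real.norm_eq_abs, abs_mul, abs_mul, mul_assoc]
    _ ≤ κ (p.2 - p.1) * (u p.2 ^ 2 + v p.1 ^ 2) := by
        refine mul_le_mul (hs.bound _ _) ?_ (by positivity) (hs.nonneg _)
        rw [← sq_abs (u p.2), ← sq_abs (v p.1)]
        nlinarith [sq_nonneg (|u p.2| - |v p.1|), sq_nonneg (|u p.2| + |v p.1|)]
    _ = _ := mul_add _ _ _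

theorem ae_integrable_and_sq_le (hs : ConvDominated μ κ s) {u : G → ℝ} (hu : MemLp u 2 μ) :
    ∀ᵐ x ∂μ, Integrable (fun y => s x y * u y) μ ∧
      (∫ y, s x y * u y ∂μ) ^ 2 ≤ (∫ z, κ z ∂μ) * ∫ y, κ (y - x) * u y ^ 2 ∂μ := by
  filter_upwards [(integrable_conv_mul_snd hs.integrable hu.integrable_sq).prod_right_ae] with x hx
  have translate := hs.integrable.comp_sub_right x
  have hx_abs : Integrable (fun y => κ (y - x) * |u y| ^ 2) μ := by simpa only [sq_abs] using hx
  have dominating := integrable_mul_of_integrable_mul_sq (fun y => hs.nonneg (y - x)) translate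
    hu.1.norm hx_abs
  have dominated (y : G) : |s x y * u y| ≤ κ (y - x) * |u y| := by
    rw [abs_mul]
    exact mul_le_mul_of_nonneg_right (hs.bound x y) (abs_nonneg _)
  have integrable : Integrable (fun y => s x y * u y) μ := dominating.mono'
    ((hs.measurable.comp measurable_prodMk_left).aestronglyMeasurable.mul hu.1)
    (Eventually.of_forall dominated)
  refine ⟨integrable, ?_⟩
  calc (∫ y, s x y * u y ∂μ) ^ 2 ≤ (∫ y, κ (y - x) * |u y| ∂μ) ^ 2 := by
        rw [← sq_abs]
        gcongr
        exact abs_integral_le_integral_abs.trans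
          (integral_mono integrable.abs dominating dominated)
    _ ≤ (∫ y, κ (y - x) ∂μ) * ∫ y, κ (y - x) * |u y| ^ 2 ∂μ :=
        sq_integral_mul_le (fun y => hs.nonneg (y - x)) translate hu.1.norm hx_abs
    _ = _ := by simp only [sq_abs, integral_sub_right_eq_self κ]

theorem memLp_integral (hs : ConvDominated μ κ s) {u : G → ℝ} (hu : MemLp u 2 μ) :
    MemLp (fun x => ∫ y, s x y * u y ∂μ) 2 μ := by
  have measurable : AEStronglyMeasurable (fun x => ∫ y, s x y * u y ∂μ) μ :=
    (hs.measurable.aestronglyMeasurable.mul hu.1.comp_snd).integral_prod_right'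
      (f := fun p : G × G => s p.1 p.2 * u p.2)
  refine (memLp_two_iff_integrable_sq measurable).mpr ?_
  refine ((integrable_conv_mul_snd hs.integrable hu.integrable_sq).integral_prod_left.const_mul
    (∫ z, κ z ∂μ)).mono' (measurable.pow 2) ?_
  filter_upwards [hs.ae_integrable_and_sq_le hu] with x hx
  rw [Real.norm_of_nonneg (sq_nonneg _)]
  exact hx.2

theorem integral_sq_le (hs : ConvDominated μ κ s) {u : G → ℝ} (hu : MemLp u 2 μ) :
    ∫ x, (∫ y, s x y * u y ∂μ) ^ 2 ∂μ ≤ (∫ z, κ z ∂μ) ^ 2 * ∫ y, u y ^ 2 ∂μ := by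
  have integrable := integrable_conv_mul_snd hs.integrable hu.integrable_sq
  calc ∫ x, (∫ y, s x y * u y ∂μ) ^ 2 ∂μ
      ≤ ∫ x, (∫ z, κ z ∂μ) * ∫ y, κ (y - x) * u y ^ 2 ∂μ ∂μ :=
        integral_mono_ae (hs.memLp_integral hu).integrable_sq
          (integrable.integral_prod_left.const_mul _)
          ((hs.ae_integrable_and_sq_le hu).mono fun x hx => hx.2)
    _ = (∫ z, κ z ∂μ) * ∫ y, ∫ x, κ (y - x) * u y ^ 2 ∂μ ∂μ := by
        rw [integral_const_mul, integral_integral_swap integrable]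
    _ = _ := by
        simp only [integral_mul_const, integral_sub_left_eq_self κ, integral_const_mul]
        ring

theorem integral_prod_self_le (hs : ConvDominated μ κ s) {u : G → ℝ} (hu : MemLp u 2 μ) :
    ∫ p, s p.1 p.2 * u p.2 * u p.1 ∂μ.prod μ ≤ (∫ z, κ z ∂μ) * ∫ x, u x ^ 2 ∂μ := by
  have integrable_snd := integrable_conv_mul_snd hs.integrable hu.integrable_sq
  have integrable_fst := integrable_conv_mul_fst hs.integrable hu.integrable_sq
  calc ∫ p, s p.1 p.2 * u p.2 * u p.1 ∂μ.prod μ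
      ≤ ∫ p : G × G, (κ (p.2 - p.1) * u p.2 ^ 2 + κ (p.2 - p.1) * u p.1 ^ 2) / 2 ∂μ.prod μ := by
        refine integral_mono (hs.integrable_prod hu hu)
          ((integrable_snd.add integrable_fst).div_const 2) fun p => ?_
        have bounds := abs_le.mp (hs.bound p.1 p.2)
        linarith [mul_nonneg (sub_nonneg.mpr bounds.2) (sq_nonneg (u p.2 + u p.1)),
          mul_nonneg (neg_le_iff_add_nonneg.mp bounds.1) (sq_nonneg (u p.2 - u p.1))]
    _ = _ := by
        rw [integral_div, integral_add integrable_snd integrable_fst,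
          integral_prod_symm _ integrable_snd, integral_prod _ integrable_fst]
        simp only [integral_mul_const, integral_sub_left_eq_self κ, integral_sub_right_eq_self κ,
          integral_const_mul]
        ring

/-- The bounded operator `u ↦ ∫ s(·, y) u(y) dμ(y)` on `L²(μ)`. -/
noncomputable def op (hs : ConvDominated μ κ s) : (G →₂[μ] ℝ) →L[ℝ] G →₂[μ] ℝ :=
  LinearMap.mkContinuous
    { toFun := fun u => (hs.memLp_integral (Lp.memLp u)).toLp _
      map_add' := fun u v => by
        rw [← MemLp.toLp_add, MemLp.toLp_eq_toLp_iff]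
        filter_upwards [hs.ae_integrable_and_sq_le (Lp.memLp u),
          hs.ae_integrable_and_sq_le (Lp.memLp v)] with x hu hv
        rw [Pi.add_apply, ← integral_add hu.1 hv.1]
        refine integral_congr_ae ?_
        filter_upwards [Lp.coeFn_add u v] with y hy
        rw [hy, Pi.add_apply, mul_add]
      map_smul' := fun c u => by
        rw [RingHom.id_apply, ← MemLp.toLp_const_smul, MemLp.toLp_eq_toLp_iff]
        refine Eventually.of_forall fun x => ?_
        rw [Pi.smul_apply, smul_eq_mul, ← integral_const_mul]
        refine integral_congr_ae ?_
        filter_upwards [Lp.coeFn_smul c u] with y hy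
        rw [hy, Pi.smul_apply, smul_eq_mul, mul_left_comm] }
    (∫ z, κ z ∂μ) fun u => by
      refine le_of_sq_le_sq ?_ (mul_nonneg (integral_nonneg hs.nonneg) (norm_nonneg _))
      rw [mul_pow, norm_sq_eq_integral_sq, norm_sq_eq_integral_sq]
      refine le_trans (le_of_eq (integral_congr_ae ?_)) (hs.integral_sq_le (Lp.memLp u))
      exact (hs.memLp_integral (Lp.memLp u)).coeFn_toLp.fun_comp (· ^ 2)

theorem coeFn_op (hs : ConvDominated μ κ s) (u : G →₂[μ] ℝ) :
    hs.op u =ᵐ[μ] fun x => ∫ y, s x y * u y ∂μ :=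
  (hs.memLp_integral (Lp.memLp u)).coeFn_toLp

theorem inner_op (hs : ConvDominated μ κ s) (u v : G →₂[μ] ℝ) :
    ⟪hs.op u, v⟫ = ∫ p, s p.1 p.2 * u p.2 * v p.1 ∂μ.prod μ := by
  rw [integral_prod _ (hs.integrable_prod (Lp.memLp u) (Lp.memLp v)), L2.inner_def]
  refine integral_congr_ae ?_
  filter_upwards [hs.coeFn_op u] with x hx
  rw [hx, integral_mul_const, RCLike.inner_apply', conj_trivial]

theorem inner_op_comm (hs : ConvDominated μ κ s) {c : ℝ} (hc : ∀ x y, s x y = c * s y x)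
    (u v : G →₂[μ] ℝ) : ⟪hs.op u, v⟫ = c * ⟪u, hs.op v⟫ := by
  rw [real_inner_comm (hs.op v) u, inner_op, inner_op, ← integral_const_mul,
    ← integral_prod_swap]
  refine integral_congr_ae (Eventually.of_forall fun p => ?_)
  simp only [Prod.fst_swap, Prod.snd_swap]
  rw [hc]
  ring

end ConvDominated

theorem ConvDominated.reflection_op (hs : ConvDominated μ κ s) {c : ℝ}
    (hc : ∀ x y, s (-x) (-y) = c * s x y) (u : G →₂[μ] ℝ) :
    reflection μ (hs.op u) = c • hs.op (reflection μ u) := by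
  refine Lp.ext ?_
  filter_upwards [coeFn_reflection (hs.op u), ae_neg (hs.coeFn_op u),
    hs.coeFn_op (reflection μ u), Lp.coeFn_smul c (hs.op (reflection μ u))] with x h_refl h_op
    h_op_refl h_smul
  rw [h_refl, h_op, h_smul, Pi.smul_apply, h_op_refl, smul_eq_mul, ← integral_const_mul,
    ← integral_neg_eq_self]
  refine integral_congr_ae ?_
  filter_upwards [coeFn_reflection u] with y hy
  rw [hy, hc, mul_assoc]

end ConvolutionDominatedKernels

section Integrals

open RealInnerProductSpace

theorem integral_pos_of_ae_pos {α : Type*} [MeasurableSpace α] {μ : Measure α} [NeZero μ]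
    {f : α → ℝ} (hf : ∀ᵐ x ∂μ, 0 < f x) (hfi : Integrable f μ) : 0 < ∫ x, f x ∂μ := by
  rw [integral_pos_iff_support_of_nonneg_ae (hf.mono fun x hx => hx.le) hfi, pos_iff_ne_zero]
  exact fun h => (NeZero.ne μ) (Measure.measure_univ_eq_zero.mp
    ((measure_congr (eventuallyEq_univ.mpr (hf.mono fun x hx => hx.ne'))).symm.trans h))

theorem inner_pos_of_ae_mul_pos {α : Type*} [MeasurableSpace α] {μ : Measure α} [NeZero μ]
    {u v : α →₂[μ] ℝ} (huv : ∀ᵐ x ∂μ, 0 < u x * v x) : 0 < ⟪u, v⟫ := by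
  rw [L2.inner_def]
  refine integral_pos_of_ae_pos (huv.mono fun x hx => ?_) (L2.integrable_inner u v)
  rwa [RCLike.inner_apply', conj_trivial]

theorem integrable_comp_abs {E : Type*} [NormedAddCommGroup E] {f : ℝ → E}
    (hf : IntegrableOn f (Set.Ioi 0)) : Integrable fun x => f |x| := by
  have right : IntegrableOn (fun x => f |x|) (Set.Ioi 0) :=
    hf.congr_fun (fun x hx => by rw [abs_of_pos hx]) measurableSet_Ioi
  have left : IntegrableOn (fun x => f |x|) (Set.Iic 0) := by
    have embedding : MeasurableEmbedding fun x : ℝ => -x := (Homeomorph.neg ℝ).measurableEmbedding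
    rw [← Measure.map_neg_eq_self (volume : Measure ℝ), embedding.integrableOn_map_iff]
    simpa [Function.comp_def, integrableOn_Ici_iff_integrableOn_Ioi] using right
  rw [← integrableOn_univ, ← Set.Iic_union_Ioi (a := 0)]
  exact left.union right

theorem integrable_abs_pow_mul_exp_neg_abs_div_two (n : ℕ) :
    Integrable fun x : ℝ => |x| ^ n * Real.exp (-(|x| / 2)) := by
  have gamma : IntegrableOn (fun x : ℝ => x ^ (n : ℝ) * Real.exp (-(1 / 2) * x ^ (1 : ℝ)))
      (Set.Ioi 0) :=
    integrableOn_rpow_mul_exp_neg_mul_rpow (by linarith [n.cast_nonneg (α := ℝ)])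
      one_pos one_half_pos
  refine (integrable_comp_abs gamma).congr (Eventually.of_forall fun x => ?_)
  simp only [Real.rpow_natCast, Real.rpow_one]
  ring_nf

end Integrals

namespace ElectronPhonon

/-- The square root `1 / (2 cosh (x/2))` of the weight `w`, as a function of `x = ε/T`. -/
noncomputable def sqrtWeight (x : ℝ) : ℝ := 1 / (2 * Real.cosh (x / 2))

/-- The even kernel `z² / (2 |sinh (z/2)|)`: conjugation by `sqrtWeight` turns `K̄₀` into the
convolution kernel `convKernel (y - x)`. -/
noncomputable def convKernel (z : ℝ) : ℝ := z ^ 2 / (2 * |Real.sinh (z / 2)|)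

/-- The relaxation rate in dimensionless variables, `Γ₀(T x) = T³ / ω₀² * rate x`. -/
noncomputable def rate (x : ℝ) : ℝ := ∫ y, convKernel (y - x) * sqrtWeight y / sqrtWeight x

section SqrtWeight

theorem sqrtWeight_pos (x : ℝ) : 0 < sqrtWeight x := by
  unfold sqrtWeight
  positivity

theorem sqrtWeight_le_one (x : ℝ) : sqrtWeight x ≤ 1 := by
  have := Real.one_le_cosh (x / 2)
  rw [sqrtWeight, div_le_one (by positivity)]
  linarith

theorem sqrtWeight_neg (x : ℝ) : sqrtWeight (-x) = sqrtWeight x := by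
  rw [sqrtWeight, sqrtWeight, neg_div, Real.cosh_neg]

theorem continuous_sqrtWeight : Continuous sqrtWeight :=
  continuous_const.div (by fun_prop) fun x => (mul_pos two_pos (Real.cosh_pos _)).ne'

theorem sqrtWeight_lt_iff {x y : ℝ} : sqrtWeight x < sqrtWeight y ↔ |y| < |x| := by
  rw [sqrtWeight, sqrtWeight, one_div_lt_one_div (by positivity) (by positivity),
    mul_lt_mul_iff_right₀ two_pos, Real.cosh_lt_cosh, abs_div, abs_div,
    div_lt_div_iff_of_pos_right (by positivity)]

theorem sqrtWeight_le_exp (x : ℝ) : sqrtWeight x ≤ Real.exp (-(|x| / 2)) := by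
  have hx : Real.exp (|x| / 2) ≤ 2 * Real.cosh (x / 2) := by
    rw [← Real.cosh_abs, abs_div, abs_two, Real.cosh_eq]
    linarith [Real.exp_pos (-(|x| / 2))]
  rw [Real.exp_neg, ← one_div]
  exact one_div_le_one_div_of_le (Real.exp_pos _) hx

theorem exp_mul_sqrtWeight_le (x y : ℝ) :
    Real.exp (-(|y - x| / 2)) * sqrtWeight x ≤ sqrtWeight y := by
  have harnack : Real.cosh (y / 2) ≤ Real.exp (|y - x| / 2) * Real.cosh (x / 2) := by
    have h_pos : Real.exp (y / 2) ≤ Real.exp (|y - x| / 2) * Real.exp (x / 2) := by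
      rw [← Real.exp_add, Real.exp_le_exp]
      linarith [le_abs_self (y - x)]
    have h_neg : Real.exp (-(y / 2)) ≤ Real.exp (|y - x| / 2) * Real.exp (-(x / 2)) := by
      rw [← Real.exp_add, Real.exp_le_exp]
      linarith [neg_abs_le (y - x)]
    rw [Real.cosh_eq, Real.cosh_eq]
    linarith
  rw [sqrtWeight, sqrtWeight, Real.exp_neg, ← div_eq_inv_mul, div_div,
    div_le_div_iff₀ (by positivity) (by positivity)]
  linarith

theorem integrable_sqrtWeight : Integrable sqrtWeight :=
  (integrable_abs_pow_mul_exp_neg_abs_div_two 0).mono' continuous_sqrtWeight.aestronglyMeasurable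
    (Eventually.of_forall fun x => by
      rw [Real.norm_of_nonneg (sqrtWeight_pos x).le, pow_zero, one_mul]
      exact sqrtWeight_le_exp x)

end SqrtWeight

section ConvKernel

theorem convKernel_nonneg (z : ℝ) : 0 ≤ convKernel z := by
  unfold convKernel
  positivity

theorem convKernel_pos {z : ℝ} (hz : z ≠ 0) : 0 < convKernel z := by
  have : Real.sinh (z / 2) ≠ 0 := by simpa using hz
  unfold convKernel
  positivity

theorem convKernel_neg (z : ℝ) : convKernel (-z) = convKernel z := by
  rw [convKernel, convKernel, neg_sq, neg_div, Real.sinh_neg, abs_neg]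

@[fun_prop]
theorem measurable_convKernel : Measurable convKernel := by
  unfold convKernel
  fun_prop

theorem convKernel_le (z : ℝ) : convKernel z ≤ |z| * (1 + |z|) * Real.exp (-(|z| / 2)) := by
  rcases eq_or_ne z 0 with rfl | hz
  · simp [convKernel]
  have hz_pos : 0 < |z| := abs_pos.mpr hz
  have h_sinh : |Real.sinh (z / 2)| = Real.sinh (|z| / 2) := by
    rw [Real.abs_sinh, abs_div, abs_two]
  rw [convKernel, h_sinh, ← sq_abs z]
  set a := |z|
  have one_add_le : 1 + a ≤ Real.exp (a / 2) * Real.exp (a / 2) := by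
    rw [← Real.exp_add, add_halves, add_comm]
    exact Real.add_one_le_exp a
  have := Real.exp_pos (a / 2)
  rw [div_le_iff₀ (mul_pos two_pos (Real.sinh_pos_iff.mpr (by positivity))), Real.sinh_eq,
    Real.exp_neg]
  field_simp
  nlinarith

theorem integrable_abs_pow_mul_convKernel (j : ℕ) : Integrable fun z => |z| ^ j * convKernel z := by
  refine ((integrable_abs_pow_mul_exp_neg_abs_div_two (j + 1)).add
    (integrable_abs_pow_mul_exp_neg_abs_div_two (j + 2))).mono' (by fun_prop)
    (Eventually.of_forall fun z => ?_)
  rw [Real.norm_of_nonneg (mul_nonneg (by positivity) (convKernel_nonneg z))]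
  calc |z| ^ j * convKernel z ≤ |z| ^ j * (|z| * (1 + |z|) * Real.exp (-(|z| / 2))) :=
        mul_le_mul_of_nonneg_left (convKernel_le z) (by positivity)
    _ = _ := by rw [Pi.add_apply]; ring

theorem integrable_convKernel : Integrable convKernel := by
  simpa using integrable_abs_pow_mul_convKernel 0

theorem integrable_pow_mul_convKernel_mul_sqrtWeight (j : ℕ) (x : ℝ) :
    Integrable fun y => (y - x) ^ j * convKernel (y - x) * sqrtWeight y := by
  have := continuous_sqrtWeight.measurable
  refine ((integrable_abs_pow_mul_convKernel j).comp_sub_right x).mono' (by fun_prop)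
    (Eventually.of_forall fun y => ?_)
  rw [Real.norm_eq_abs, abs_mul, abs_mul, abs_pow, abs_of_nonneg (convKernel_nonneg _),
    abs_of_pos (sqrtWeight_pos y)]
  exact mul_le_of_le_one_right (mul_nonneg (by positivity) (convKernel_nonneg _))
    (sqrtWeight_le_one y)

theorem integrable_convKernel_mul_sqrtWeight (x : ℝ) :
    Integrable fun y => convKernel (y - x) * sqrtWeight y := by
  simpa using integrable_pow_mul_convKernel_mul_sqrtWeight 0 x

/-- The drift is towards the Fermi level: pairing the jumps `z` and `-z` from `x`, the one towards
`0` has the larger weight. -/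
theorem integral_mul_convKernel_mul_sqrtWeight_neg {x : ℝ} (hx : 0 < x) :
    ∫ y, (y - x) * convKernel (y - x) * sqrtWeight y < 0 := by
  set F : ℝ → ℝ := fun z => z * convKernel z * sqrtWeight (z + x) with hF
  have integral_eq : ∫ y, (y - x) * convKernel (y - x) * sqrtWeight y = ∫ z, F z := by
    rw [← integral_sub_right_eq_self F x]
    simp only [hF, sub_add_cancel]
  have integrable : Integrable F := by
    simpa [hF] using (integrable_pow_mul_convKernel_mul_sqrtWeight 1 x).comp_add_right x
  have paired (z : ℝ) : -(F z + F (-z))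
      = convKernel z * (z * (sqrtWeight (z - x) - sqrtWeight (z + x))) := by
    have : sqrtWeight (-z + x) = sqrtWeight (z - x) := by rw [← sqrtWeight_neg, neg_add', neg_neg]
    simp only [hF, convKernel_neg, this]
    ring
  have paired_pos : ∀ z ≠ 0, 0 < -(F z + F (-z)) := by
    intro z hz
    rw [paired]
    refine mul_pos (convKernel_pos hz) ?_
    rcases lt_or_gt_of_ne hz with h | h
    · refine mul_pos_of_neg_of_neg h (sub_neg.mpr (sqrtWeight_lt_iff.mpr (sq_lt_sq.mp ?_)))
      nlinarith
    · refine mul_pos h (sub_pos.mpr (sqrtWeight_lt_iff.mpr (sq_lt_sq.mp ?_)))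
      nlinarith
  have integral_paired_pos : 0 < ∫ z, -(F z + F (-z)) :=
    integral_pos_of_ae_pos ((Measure.ae_ne volume 0).mono paired_pos)
      (integrable.add integrable.comp_neg).neg
  rw [integral_neg, integral_add integrable integrable.comp_neg, integral_neg_eq_self]
    at integral_paired_pos
  linarith

end ConvKernel

section Rate

theorem integral_convKernel_mul_sqrtWeight (x : ℝ) :
    ∫ y, convKernel (y - x) * sqrtWeight y = rate x * sqrtWeight x := by
  rw [rate, integral_div, div_mul_cancel₀ _ (sqrtWeight_pos x).ne']

theorem rate_neg (x : ℝ) : rate (-x) = rate x := by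
  rw [rate, rate, ← integral_neg_eq_self]
  congr 1 with y
  rw [sqrtWeight_neg, sqrtWeight_neg, ← neg_sub', convKernel_neg]

theorem measurable_rate : Measurable rate := by
  have := continuous_sqrtWeight.measurable
  have kernel : StronglyMeasurable (Function.uncurry fun x y : ℝ =>
      convKernel (y - x) * sqrtWeight y / sqrtWeight x) :=
    Measurable.stronglyMeasurable (by fun_prop)
  exact kernel.integral_prod_right.measurable

/-- A positive lower bound of the relaxation rate, obtained from Harnack's inequality
`exp_mul_sqrtWeight_le`. -/
noncomputable def rateMin : ℝ := ∫ z, convKernel z * Real.exp (-(|z| / 2))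

theorem integrable_convKernel_mul_exp :
    Integrable fun z => convKernel z * Real.exp (-(|z| / 2)) :=
  integrable_convKernel.mul_bdd (c := 1) (by fun_prop)
    (Eventually.of_forall fun z => by
      rw [Real.norm_of_nonneg (Real.exp_pos _).le, Real.exp_le_one_iff]
      linarith [abs_nonneg z])

theorem rateMin_pos : 0 < rateMin :=
  integral_pos_of_ae_pos ((Measure.ae_ne volume 0).mono fun _ hz =>
    mul_pos (convKernel_pos hz) (Real.exp_pos _)) integrable_convKernel_mul_exp

theorem rateMin_le (x : ℝ) : rateMin ≤ rate x := by
  rw [rateMin, ← integral_sub_right_eq_self _ x, rate]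
  refine integral_mono (integrable_convKernel_mul_exp.comp_sub_right x)
    ((integrable_convKernel_mul_sqrtWeight x).div_const _) fun y => ?_
  dsimp only
  rw [mul_div_assoc]
  exact mul_le_mul_of_nonneg_left
    ((le_div_iff₀ (sqrtWeight_pos x)).mpr (exp_mul_sqrtWeight_le x y)) (convKernel_nonneg _)

theorem rate_pos (x : ℝ) : 0 < rate x := rateMin_pos.trans_le (rateMin_le x)

theorem rate_mul_sqrtWeight_le (x : ℝ) : rate x * sqrtWeight x ≤ ∫ z, convKernel z := by
  rw [← integral_convKernel_mul_sqrtWeight, ← integral_sub_right_eq_self convKernel x]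
  exact integral_mono (integrable_convKernel_mul_sqrtWeight x)
    (integrable_convKernel.comp_sub_right x)
    fun y => mul_le_of_le_one_right (convKernel_nonneg _) (sqrtWeight_le_one y)

theorem half_le_convKernel_mul_sqrtWeight_div {x y : ℝ} (hy : 0 ≤ y) (hyx : y + 1 ≤ x) :
    1 / 2 ≤ convKernel (y - x) * sqrtWeight y / sqrtWeight x := by
  obtain ⟨s, hs, rfl⟩ : ∃ s, 1 ≤ s ∧ x = y + s := ⟨x - y, by linarith, by ring⟩
  have sinh_s : 0 < Real.sinh (s / 2) := Real.sinh_pos_iff.mpr (by linarith)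
  have sinh_y : 0 ≤ Real.sinh (y / 2) := Real.sinh_nonneg_iff.mpr (by linarith)
  have cosh_y := Real.cosh_pos (y / 2)
  have cosh_mul_sinh_le :
      Real.cosh (y / 2) * Real.sinh (s / 2) ≤ Real.cosh ((y + s) / 2) := by
    rw [add_div, Real.cosh_add]
    nlinarith [mul_nonneg sinh_y sinh_s.le, Real.sinh_lt_cosh (s / 2)]
  have value : convKernel (y - (y + s)) * sqrtWeight y / sqrtWeight (y + s)
      = s ^ 2 * Real.cosh ((y + s) / 2) / (2 * (Real.cosh (y / 2) * Real.sinh (s / 2))) := by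
    rw [sub_add_cancel_left, convKernel_neg, convKernel, sqrtWeight, sqrtWeight,
      abs_of_pos sinh_s]
    field_simp
  rw [value, div_le_div_iff₀ (by positivity) (by positivity)]
  linarith [le_mul_of_one_le_left (Real.cosh_pos ((y + s) / 2)).le (one_le_pow₀ hs (n := 2))]

theorem abs_sub_one_div_two_le_rate (x : ℝ) : (|x| - 1) / 2 ≤ rate x := by
  wlog hx : 0 ≤ x generalizing x
  · simpa only [abs_neg, rate_neg] using this (-x) (by linarith)
  rw [abs_of_nonneg hx]
  rcases lt_or_ge x 1 with hx_lt | hx_ge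
  · linarith [rate_pos x]
  have integrable := (integrable_convKernel_mul_sqrtWeight x).div_const (sqrtWeight x)
  calc (x - 1) / 2 = ∫ y in Set.Icc 0 (x - 1), (1 / 2 : ℝ) := by
        simp [hx_ge, div_eq_mul_inv]
    _ ≤ ∫ y in Set.Icc 0 (x - 1), convKernel (y - x) * sqrtWeight y / sqrtWeight x :=
        setIntegral_mono_on (by simp) integrable.integrableOn measurableSet_Icc fun y hy =>
          half_le_convKernel_mul_sqrtWeight_div hy.1 (by linarith [hy.2])
    _ ≤ rate x := setIntegral_le_integral integrable (Eventually.of_forall fun y =>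
        div_nonneg (mul_nonneg (convKernel_nonneg _) (sqrtWeight_pos y).le) (sqrtWeight_pos x).le)

end Rate

section Kernel

theorem fermi_eq (y : ℝ) : fermi y = Real.exp (-(y / 2)) * sqrtWeight y := by
  have exp_eq : Real.exp y = Real.exp (y / 2) ^ 2 := by rw [sq, ← Real.exp_add, add_halves]
  rw [fermi, sqrtWeight, exp_eq, Real.cosh_eq, Real.exp_neg]
  have := Real.exp_pos (y / 2)
  field_simp

theorem one_sub_fermi_eq (y : ℝ) : 1 - fermi y = Real.exp (y / 2) * sqrtWeight y := by
  have exp_eq : Real.exp y = Real.exp (y / 2) ^ 2 := by rw [sq, ← Real.exp_add, add_halves]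
  rw [fermi, sqrtWeight, exp_eq, Real.cosh_eq, Real.exp_neg]
  have := Real.exp_pos (y / 2)
  field_simp
  ring

theorem bose_eq (z : ℝ) : bose z = Real.exp (-(z / 2)) / (2 * Real.sinh (z / 2)) := by
  have factor : Real.exp z - 1 = Real.exp (z / 2) * (2 * Real.sinh (z / 2)) := by
    rw [Real.sinh_eq, mul_div_cancel₀ _ two_ne_zero, mul_sub, ← Real.exp_add, ← Real.exp_add,
      add_halves, add_neg_cancel, Real.exp_zero]
  rw [bose, factor, ← div_div, one_div, ← Real.exp_neg]

theorem weight_eq (T ε : ℝ) : weight T ε = sqrtWeight (ε / T) ^ 2 := by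
  rw [weight, one_sub_fermi_eq, fermi_eq, mul_mul_mul_comm, ← Real.exp_add, neg_add_cancel,
    Real.exp_zero, one_mul, sq]

theorem bose_add_fermi {x y : ℝ} (hyx : y ≠ x) :
    bose (y - x) + fermi y = sqrtWeight y / sqrtWeight x / (2 * Real.sinh ((y - x) / 2)) := by
  have sinh_ne : Real.sinh ((y - x) / 2) ≠ 0 := by simpa [sub_eq_zero] using hyx
  have exp_split : Real.exp (-((y - x) / 2)) = Real.exp (-(y / 2)) * Real.exp (x / 2) := by
    rw [← Real.exp_add]
    ring_nf
  have exp_mul_cosh : Real.exp (x / 2) * Real.cosh (y / 2) + Real.sinh ((y - x) / 2)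
      = Real.exp (y / 2) * Real.cosh (x / 2) := by
    rw [← Real.cosh_add_sinh, ← Real.cosh_add_sinh, sub_div, Real.sinh_sub]
    ring
  have exp_cancel : Real.exp (-(y / 2)) * Real.exp (y / 2) = 1 := by
    rw [← Real.exp_add, neg_add_cancel, Real.exp_zero]
  rw [bose_eq, fermi_eq, exp_split, sqrtWeight, sqrtWeight]
  field_simp
  linear_combination Real.exp (-(y / 2)) * exp_mul_cosh + Real.cosh (x / 2) * exp_cancel

theorem Kbar0_eq (ω₀ : ℝ) {T : ℝ} (hT : 0 < T) (x y : ℝ) :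
    Kbar0 ω₀ T (T * x) (T * y)
      = (T / ω₀) ^ 2 * (convKernel (y - x) * sqrtWeight y / sqrtWeight x) := by
  have scale : T * y - T * x = T * (y - x) := (mul_sub _ _ _).symm
  rw [Kbar0, potential, scale, mul_div_cancel_left₀ _ hT.ne', mul_div_cancel_left₀ _ hT.ne']
  rcases eq_or_ne y x with rfl | hyx
  · simp [convKernel]
  have sign : Real.sign (T * (y - x)) / Real.sinh ((y - x) / 2)
      = 1 / |Real.sinh ((y - x) / 2)| := by
    rcases lt_or_gt_of_ne hyx with h | h
    · rw [Real.sign_of_neg (mul_neg_of_pos_of_neg hT (sub_neg.mpr h)),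
        abs_of_neg (Real.sinh_neg_iff.mpr (by linarith)), div_neg, neg_div]
    · rw [Real.sign_of_pos (mul_pos hT (sub_pos.mpr h)),
        abs_of_pos (Real.sinh_pos_iff.mpr (by linarith))]
  calc _ = sqrtWeight y / sqrtWeight x / 2 * (T * (y - x) / ω₀) ^ 2
        * (Real.sign (T * (y - x)) / Real.sinh ((y - x) / 2)) := by
        rw [bose_add_fermi hyx]
        ring
    _ = _ := by
        rw [sign, convKernel]
        ring

end Kernel

open RealInnerProductSpace

section Operators

theorem sqrt_rate_pos (x : ℝ) : 0 < √(rate x) := Real.sqrt_pos.mpr (rate_pos x)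

/-- The kernel `(y - x) ^ j * K̄₀` in dimensionless variables, transported from `L²_σ` to
`L²(ℝ)`, where it becomes symmetric (`j` even) or antisymmetric (`j` odd). -/
noncomputable def symKernel (j : ℕ) (x y : ℝ) : ℝ :=
  (y - x) ^ j * convKernel (y - x) / (√(rate x) * √(rate y))

theorem symKernel_comm (j : ℕ) (x y : ℝ) : symKernel j x y = (-1) ^ j * symKernel j y x := by
  rw [symKernel, symKernel, ← neg_sub x y, convKernel_neg, neg_pow, mul_comm √(rate y), mul_assoc,
    mul_div_assoc]

theorem symKernel_neg (j : ℕ) (x y : ℝ) : symKernel j (-x) (-y) = (-1) ^ j * symKernel j x y := by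
  rw [symKernel, symKernel, ← neg_sub', convKernel_neg, neg_pow, rate_neg, rate_neg, mul_assoc,
    mul_div_assoc]

theorem convDominated_symKernel (j : ℕ) :
    ConvDominated volume (fun z => |z| ^ j * convKernel z / rateMin) (symKernel j) where
  integrable := (integrable_abs_pow_mul_convKernel j).div_const _
  measurable := by
    have := measurable_rate
    unfold symKernel Function.uncurry
    fun_prop
  bound x y := by
    have rateMin_le_sqrt_mul : rateMin ≤ √(rate x) * √(rate y) := by
      rw [← Real.mul_self_sqrt rateMin_pos.le]
      gcongr <;> exact rateMin_le _
    rw [symKernel, abs_div, abs_mul, abs_pow, abs_of_nonneg (convKernel_nonneg _),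
      abs_of_pos (mul_pos (sqrt_rate_pos x) (sqrt_rate_pos y))]
    exact div_le_div_of_nonneg_left (mul_nonneg (by positivity) (convKernel_nonneg _))
      rateMin_pos rateMin_le_sqrt_mul

/-- The bounded operator on `L²(ℝ)` with the kernel `symKernel j`. -/
noncomputable def scatOp (j : ℕ) : (ℝ →₂[volume] ℝ) →L[ℝ] ℝ →₂[volume] ℝ :=
  (convDominated_symKernel j).op

theorem inner_scatOp_comm (j : ℕ) (u v : ℝ →₂[volume] ℝ) :
    ⟪scatOp j u, v⟫ = (-1) ^ j * ⟪u, scatOp j v⟫ :=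
  (convDominated_symKernel j).inner_op_comm (symKernel_comm j) u v

theorem reflection_scatOp (j : ℕ) (u : ℝ →₂[volume] ℝ) :
    reflection volume (scatOp j u) = (-1 : ℝ) ^ j • scatOp j (reflection volume u) :=
  (convDominated_symKernel j).reflection_op (symKernel_neg j) u

end Operators

section SqrtDensity

/-- The square root of the density of `σ` in dimensionless variables: multiplication by
`sqrtDensity` maps functions in `L²_σ` to functions in `L²(ℝ)`. -/
noncomputable def sqrtDensity (x : ℝ) : ℝ := sqrtWeight x * √(rate x)

theorem sqrtDensity_pos (x : ℝ) : 0 < sqrtDensity x := mul_pos (sqrtWeight_pos x) (sqrt_rate_pos x)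

theorem sqrtDensity_neg (x : ℝ) : sqrtDensity (-x) = sqrtDensity x := by
  rw [sqrtDensity, sqrtDensity, sqrtWeight_neg, rate_neg]

theorem measurable_sqrtDensity : Measurable sqrtDensity :=
  continuous_sqrtWeight.measurable.mul measurable_rate.sqrt

theorem sqrtDensity_sq (x : ℝ) : sqrtDensity x ^ 2 = sqrtWeight x * (rate x * sqrtWeight x) := by
  rw [sqrtDensity, mul_pow, Real.sq_sqrt (rate_pos x).le]
  ring

theorem memLp_sqrtDensity : MemLp sqrtDensity 2 := by
  rw [memLp_two_iff_integrable_sq measurable_sqrtDensity.aestronglyMeasurable]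
  refine (integrable_sqrtWeight.mul_const (∫ z, convKernel z)).mono'
    (measurable_sqrtDensity.pow_const 2).aestronglyMeasurable (Eventually.of_forall fun x => ?_)
  rw [Real.norm_of_nonneg (sq_nonneg _), sqrtDensity_sq]
  exact mul_le_mul_of_nonneg_left (rate_mul_sqrtWeight_le x) (sqrtWeight_pos x).le

/-- `sqrtDensity` as an element of `L²(ℝ)`; it represents the constant function `1` of `L²_σ`. -/
noncomputable def sqrtDensityLp : ℝ →₂[volume] ℝ := memLp_sqrtDensity.toLp sqrtDensity

theorem coeFn_sqrtDensityLp : sqrtDensityLp =ᵐ[volume] sqrtDensity := memLp_sqrtDensity.coeFn_toLp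

theorem reflection_sqrtDensityLp : reflection volume sqrtDensityLp = sqrtDensityLp := by
  refine Lp.ext ?_
  filter_upwards [coeFn_reflection sqrtDensityLp, ae_neg coeFn_sqrtDensityLp, coeFn_sqrtDensityLp]
    with x h_refl h_neg h_pos
  rw [h_refl, h_neg, h_pos, sqrtDensity_neg]

theorem coeFn_scatOp_sqrtDensityLp (j : ℕ) :
    scatOp j sqrtDensityLp =ᵐ[volume] fun x =>
      (∫ y, (y - x) ^ j * convKernel (y - x) * sqrtWeight y) / √(rate x) := by
  filter_upwards [(convDominated_symKernel j).coeFn_op sqrtDensityLp] with x hx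
  rw [scatOp, hx, ← integral_div]
  refine integral_congr_ae ?_
  filter_upwards [coeFn_sqrtDensityLp] with y hy
  have := (sqrt_rate_pos y).ne'
  have := (sqrt_rate_pos x).ne'
  rw [hy, symKernel, sqrtDensity]
  field_simp

theorem scatOp_zero_sqrtDensityLp : scatOp 0 sqrtDensityLp = sqrtDensityLp := by
  refine Lp.ext ?_
  filter_upwards [coeFn_scatOp_sqrtDensityLp 0, coeFn_sqrtDensityLp] with x h_op h_coe
  simp only [pow_zero, one_mul] at h_op
  rw [h_op, h_coe, integral_convKernel_mul_sqrtWeight, sqrtDensity,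
    div_eq_iff (sqrt_rate_pos x).ne', mul_assoc, Real.mul_self_sqrt (rate_pos x).le, mul_comm]

theorem scatOp_one_sqrtDensityLp_ne_zero : scatOp 1 sqrtDensityLp ≠ 0 := by
  intro h_zero
  have nonpos : ∀ᵐ x : ℝ, x ≤ 0 := by
    filter_upwards [coeFn_scatOp_sqrtDensityLp 1, Lp.coeFn_zero ℝ 2 (volume : Measure ℝ)]
      with x h_op h_coe
    by_contra! hx
    have drift := integral_mul_convKernel_mul_sqrtWeight_neg hx
    simp only [h_zero, h_coe, Pi.zero_apply, pow_one] at h_op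
    exact (div_neg_of_neg_of_pos drift (sqrt_rate_pos x)).ne h_op.symm
  simp only [ae_iff, not_le] at nonpos
  exact (Measure.measure_Ioi_pos volume (0 : ℝ)).ne' nonpos

theorem inner_scatOp_two_sqrtDensityLp_pos : 0 < ⟪scatOp 2 sqrtDensityLp, sqrtDensityLp⟫ := by
  refine inner_pos_of_ae_mul_pos ?_
  filter_upwards [coeFn_scatOp_sqrtDensityLp 2, coeFn_sqrtDensityLp] with x h_op h_coe
  have second_moment_pos : 0 < ∫ y, (y - x) ^ 2 * convKernel (y - x) * sqrtWeight y := by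
    refine integral_pos_of_ae_pos ((Measure.ae_ne volume x).mono fun y hy => ?_)
      (integrable_pow_mul_convKernel_mul_sqrtWeight 2 x)
    have hyx : y - x ≠ 0 := sub_ne_zero.mpr hy
    exact mul_pos (mul_pos (by positivity) (convKernel_pos hyx)) (sqrtWeight_pos y)
  rw [h_op, h_coe]
  exact mul_pos (div_pos second_moment_pos (sqrt_rate_pos x)) (sqrtDensity_pos x)

end SqrtDensity

section Source

/-- The source term `1 / Γ₀` in dimensionless variables, transported to `L²(ℝ)`. -/
noncomputable def source (x : ℝ) : ℝ := sqrtWeight x / √(rate x)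

theorem memLp_source : MemLp source 2 := by
  have measurable : Measurable source := continuous_sqrtWeight.measurable.div measurable_rate.sqrt
  rw [memLp_two_iff_integrable_sq measurable.aestronglyMeasurable]
  refine (integrable_sqrtWeight.div_const rateMin).mono'
    (measurable.pow_const 2).aestronglyMeasurable (Eventually.of_forall fun x => ?_)
  rw [Real.norm_of_nonneg (sq_nonneg _), source, div_pow, Real.sq_sqrt (rate_pos x).le, sq]
  exact div_le_div₀ (sqrtWeight_pos x).le
    (mul_le_of_le_one_left (sqrtWeight_pos x).le (sqrtWeight_le_one x)) rateMin_pos (rateMin_le x)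

/-- `source` as an element of `L²(ℝ)`. -/
noncomputable def sourceLp : ℝ →₂[volume] ℝ := memLp_source.toLp source

theorem coeFn_sourceLp : sourceLp =ᵐ[volume] source := memLp_source.coeFn_toLp

theorem inner_sqrtDensityLp_sourceLp_pos : 0 < ⟪sqrtDensityLp, sourceLp⟫ := by
  refine inner_pos_of_ae_mul_pos ?_
  filter_upwards [coeFn_sqrtDensityLp, coeFn_sourceLp] with x h_density h_source
  rw [h_density, h_source]
  exact mul_pos (sqrtDensity_pos x) (div_pos (sqrtWeight_pos x) (sqrt_rate_pos x))

end Source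

end ElectronPhonon

section LocalPoincare

/-- Freezing the second variable at a point `t ∈ B` where the inner integral of the energy is at
most its average over `B` turns the nonlocal energy into a local one on `A`. -/
theorem exists_setIntegral_mul_sq_sub_le {α : Type*} [MeasurableSpace α] {μ : Measure α}
    [SFinite μ] {J : α → α → ℝ} {g k : α → ℝ} {A B : Set α} (hA : MeasurableSet A)
    (hB : MeasurableSet B) (hB_ne_zero : μ B ≠ 0) (hB_ne_top : μ B ≠ ⊤) (hJ : ∀ x y, 0 ≤ J x y)
    (hk : ∀ x ∈ A, 0 ≤ k x) (hkJ : ∀ x ∈ A, ∀ y ∈ B, k x ≤ J x y)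
    (hint : Integrable (fun p : α × α => J p.1 p.2 * (g p.1 - g p.2) ^ 2) (μ.prod μ)) :
    ∃ t, μ.real B * ∫ x in A, k x * (g x - g t) ^ 2 ∂μ
      ≤ ∫ p, J p.1 p.2 * (g p.1 - g p.2) ^ 2 ∂μ.prod μ := by
  set F : α → α → ℝ := fun x t => J x t * (g x - g t) ^ 2
  have F_nonneg (x t : α) : 0 ≤ F x t := mul_nonneg (hJ x t) (sq_nonneg _)
  have null : (μ.restrict B) ({t | Integrable (fun x => F x t) μ}ᶜ ∪ Bᶜ) = 0 :=
    measure_union_null (Measure.absolutelyContinuous_of_le Measure.restrict_le_self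
      hint.prod_left_ae) (by rw [Measure.restrict_apply hB.compl, Set.compl_inter_self,
        measure_empty])
  have : IsFiniteMeasure (μ.restrict B) :=
    ⟨by rw [Measure.restrict_apply_univ]; exact hB_ne_top.lt_top⟩
  obtain ⟨t, ht, le_average⟩ := exists_notMem_null_le_average
    (by rwa [Ne, Measure.restrict_eq_zero]) hint.integral_prod_right.integrableOn null
  simp only [Set.mem_union, Set.mem_compl_iff, Set.mem_ofPred_eq, not_or, not_not] at ht
  have le_slice : ∫ x in A, k x * (g x - g t) ^ 2 ∂μ ≤ ∫ x, F x t ∂μ := by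
    refine (integral_mono_of_nonneg ?_ ht.1.integrableOn ?_).trans
      (setIntegral_le_integral ht.1 (Eventually.of_forall fun x => F_nonneg x t))
    · filter_upwards [ae_restrict_mem hA] with x hx using mul_nonneg (hk x hx) (sq_nonneg _)
    · filter_upwards [ae_restrict_mem hA] with x hx
      exact mul_le_mul_of_nonneg_right (hkJ x hx t ht.2) (sq_nonneg _)
  have average_eq_div : ⨍ t in B, ∫ x, F x t ∂μ ∂μ = (∫ t in B, ∫ x, F x t ∂μ ∂μ) / μ.real B := by
    rw [average_eq, measureReal_restrict_apply_univ, smul_eq_mul, inv_mul_eq_div]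
  have measure_pos : 0 < μ.real B := ENNReal.toReal_pos hB_ne_zero hB_ne_top
  refine ⟨t, ?_⟩
  calc μ.real B * ∫ x in A, k x * (g x - g t) ^ 2 ∂μ
      ≤ μ.real B * ⨍ t in B, ∫ x, F x t ∂μ ∂μ :=
        mul_le_mul_of_nonneg_left (le_slice.trans le_average) measure_pos.le
    _ = ∫ t in B, ∫ x, F x t ∂μ ∂μ := by rw [average_eq_div, mul_div_cancel₀ _ measure_pos.ne']
    _ ≤ ∫ t, ∫ x, F x t ∂μ ∂μ := setIntegral_le_integral hint.integral_prod_right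
        (Eventually.of_forall fun t => integral_nonneg fun x => F_nonneg x t)
    _ = _ := (integral_prod_symm _ hint).symm

end LocalPoincare

namespace ElectronPhonon

open RealInnerProductSpace

section CollisionOperator

/-- The collision operator `1 - K₀`, transported to `L²(ℝ)`. -/
noncomputable def collisionOp : (ℝ →₂[volume] ℝ) →L[ℝ] ℝ →₂[volume] ℝ :=
  ContinuousLinearMap.id ℝ _ - scatOp 0

theorem collisionOp_apply (u : ℝ →₂[volume] ℝ) : collisionOp u = u - scatOp 0 u := rfl

theorem collisionOp_sqrtDensityLp : collisionOp sqrtDensityLp = 0 := by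
  rw [collisionOp_apply, scatOp_zero_sqrtDensityLp, sub_self]

theorem inner_collisionOp_comm (u v : ℝ →₂[volume] ℝ) :
    ⟪collisionOp u, v⟫ = ⟪u, collisionOp v⟫ := by
  rw [collisionOp_apply, collisionOp_apply, inner_sub_left, inner_sub_right, inner_scatOp_comm,
    pow_zero, one_mul]

theorem inner_collisionOp_self (u : ℝ →₂[volume] ℝ) :
    ⟪collisionOp u, u⟫ = ‖u‖ ^ 2 - ⟪scatOp 0 u, u⟫ := by
  rw [collisionOp_apply, inner_sub_left, real_inner_self_eq_norm_sq]

theorem reflection_collisionOp (u : ℝ →₂[volume] ℝ) :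
    reflection volume (collisionOp u) = collisionOp (reflection volume u) := by
  rw [collisionOp_apply, collisionOp_apply, map_sub, reflection_scatOp, pow_zero, one_smul]

theorem inner_collisionOp_sub_smul (u : ℝ →₂[volume] ℝ) (m : ℝ) :
    ⟪collisionOp (u - m • sqrtDensityLp), u - m • sqrtDensityLp⟫ = ⟪collisionOp u, u⟫ := by
  rw [map_sub, map_smul, collisionOp_sqrtDensityLp, smul_zero, sub_zero, inner_sub_right,
    inner_smul_right, inner_collisionOp_comm u sqrtDensityLp, collisionOp_sqrtDensityLp,
    inner_zero_right, mul_zero, sub_zero]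

end CollisionOperator

section Energy

/-- The density of the symmetric jump measure of the scattering process. -/
noncomputable def jump (x y : ℝ) : ℝ := convKernel (y - x) * sqrtWeight x * sqrtWeight y

theorem jump_nonneg (x y : ℝ) : 0 ≤ jump x y :=
  mul_nonneg (mul_nonneg (convKernel_nonneg _) (sqrtWeight_pos _).le) (sqrtWeight_pos _).le

theorem jump_comm (x y : ℝ) : jump x y = jump y x := by
  rw [jump, jump, ← neg_sub x y, convKernel_neg, mul_right_comm]

theorem measurable_jump : Measurable fun p : ℝ × ℝ => jump p.1 p.2 := by
  have := continuous_sqrtWeight.measurable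
  unfold jump
  fun_prop

variable (u : ℝ →₂[volume] ℝ)

theorem integral_jump_mul_sq (x : ℝ) : ∫ y, jump x y * (u x / sqrtDensity x) ^ 2 = u x ^ 2 := by
  have factor (y : ℝ) : jump x y * (u x / sqrtDensity x) ^ 2
      = sqrtWeight x * (u x / sqrtDensity x) ^ 2 * (convKernel (y - x) * sqrtWeight y) := by
    rw [jump]
    ring
  have := (sqrtWeight_pos x).ne'
  have := (rate_pos x).ne'
  simp_rw [factor]
  rw [integral_const_mul, integral_convKernel_mul_sqrtWeight, div_pow, sqrtDensity_sq]
  field_simp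

theorem integrable_jump_mul_sq_fst :
    Integrable (fun p : ℝ × ℝ => jump p.1 p.2 * (u p.1 / sqrtDensity p.1) ^ 2)
      (volume.prod volume) := by
  have measurable : AEStronglyMeasurable (fun x => u x / sqrtDensity x) :=
    ((Lp.aestronglyMeasurable u).aemeasurable.div
      measurable_sqrtDensity.aemeasurable).aestronglyMeasurable
  have measurable_prod : AEStronglyMeasurable
      (fun p : ℝ × ℝ => jump p.1 p.2 * (u p.1 / sqrtDensity p.1) ^ 2) (volume.prod volume) :=
    measurable_jump.aestronglyMeasurable.mul (measurable.comp_fst.pow 2)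
  refine (integrable_prod_iff measurable_prod).mpr ⟨Eventually.of_forall fun x => ?_, ?_⟩
  · refine ((integrable_convKernel_mul_sqrtWeight x).const_mul
      (sqrtWeight x * (u x / sqrtDensity x) ^ 2)).congr (Eventually.of_forall fun y => ?_)
    simp only [jump]
    ring
  · refine (Lp.memLp u).integrable_sq.congr (Eventually.of_forall fun x => ?_)
    simp only [Real.norm_of_nonneg (mul_nonneg (jump_nonneg _ _) (sq_nonneg _)),
      integral_jump_mul_sq]

theorem integrable_jump_mul_sq_snd :
    Integrable (fun p : ℝ × ℝ => jump p.1 p.2 * (u p.2 / sqrtDensity p.2) ^ 2)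
      (volume.prod volume) := by
  refine (integrable_jump_mul_sq_fst u).swap.congr (Eventually.of_forall fun p => ?_)
  simp only [Function.comp_apply, Prod.fst_swap, Prod.snd_swap, jump_comm p.2 p.1]

theorem jump_mul_sub_sq (x y : ℝ) :
    jump x y * (u x / sqrtDensity x - u y / sqrtDensity y) ^ 2
      = jump x y * (u x / sqrtDensity x) ^ 2 + jump x y * (u y / sqrtDensity y) ^ 2
        - 2 * (symKernel 0 x y * u y * u x) := by
  have cross : jump x y * (u x / sqrtDensity x * (u y / sqrtDensity y))
      = symKernel 0 x y * u y * u x := by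
    have := (sqrtWeight_pos x).ne'
    have := (sqrtWeight_pos y).ne'
    have := (sqrt_rate_pos x).ne'
    have := (sqrt_rate_pos y).ne'
    unfold jump symKernel sqrtDensity
    field_simp
  rw [← cross]
  ring

theorem integrable_energy :
    Integrable (fun p : ℝ × ℝ =>
      jump p.1 p.2 * (u p.1 / sqrtDensity p.1 - u p.2 / sqrtDensity p.2) ^ 2)
      (volume.prod volume) := by
  simp_rw [jump_mul_sub_sq]
  exact ((integrable_jump_mul_sq_fst u).add (integrable_jump_mul_sq_snd u)).sub
    (((convDominated_symKernel 0).integrable_prod (Lp.memLp u) (Lp.memLp u)).const_mul 2)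

theorem integral_energy :
    ∫ p : ℝ × ℝ, jump p.1 p.2 * (u p.1 / sqrtDensity p.1 - u p.2 / sqrtDensity p.2) ^ 2
      ∂volume.prod volume = 2 * ⟪collisionOp u, u⟫ := by
  have integrable_fst := integrable_jump_mul_sq_fst u
  have integrable_snd := integrable_jump_mul_sq_snd u
  have integral_fst : ∫ p : ℝ × ℝ, jump p.1 p.2 * (u p.1 / sqrtDensity p.1) ^ 2
      ∂volume.prod volume = ‖u‖ ^ 2 := by
    rw [integral_prod _ integrable_fst, norm_sq_eq_integral_sq]
    simp_rw [integral_jump_mul_sq]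
  have integral_snd : ∫ p : ℝ × ℝ, jump p.1 p.2 * (u p.2 / sqrtDensity p.2) ^ 2
      ∂volume.prod volume = ‖u‖ ^ 2 := by
    rw [← integral_fst, ← integral_prod_swap]
    simp only [Prod.fst_swap, Prod.snd_swap, jump_comm]
  simp_rw [jump_mul_sub_sq]
  rw [integral_sub (integrable_fst.fun_add integrable_snd)
      (((convDominated_symKernel 0).integrable_prod (Lp.memLp u) (Lp.memLp u)).const_mul 2),
    integral_add integrable_fst integrable_snd, integral_fst, integral_snd, integral_const_mul,
    inner_collisionOp_self, scatOp, ConvDominated.inner_op]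
  ring

end Energy

section SpectralGap

theorem integral_convKernel_pos : 0 < ∫ z, convKernel z :=
  integral_pos_of_ae_pos ((Measure.ae_ne volume 0).mono fun _ => convKernel_pos)
    integrable_convKernel

theorem exists_mul_sqrtDensity_sq_le_jump {R : ℝ} (hR : 0 < R) :
    ∃ c > 0, ∀ x ∈ Set.Icc (-R) R, ∀ y ∈ Set.Icc (R + 1) (R + 2),
      c * sqrtDensity x ^ 2 ≤ jump x y := by
  set N := ∫ z, convKernel z
  have N_pos : 0 < N := integral_convKernel_pos
  have : 0 < Real.sinh (R + 1) := Real.sinh_pos_iff.mpr (by linarith)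
  have weight_pos := sqrtWeight_pos (R + 2)
  refine ⟨1 / (2 * Real.sinh (R + 1)) * sqrtWeight (R + 2) / N, by positivity,
    fun x hx y hy => ?_⟩
  have one_le : 1 ≤ y - x := by linarith [hx.2, hy.1]
  have kernel_ge : 1 / (2 * Real.sinh (R + 1)) ≤ convKernel (y - x) := by
    have sinh_half_pos : 0 < Real.sinh ((y - x) / 2) := Real.sinh_pos_iff.mpr (by linarith)
    have sinh_half_le : Real.sinh ((y - x) / 2) ≤ Real.sinh (R + 1) :=
      Real.sinh_le_sinh.mpr (by linarith [hx.1, hy.2])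
    rw [convKernel, abs_of_pos sinh_half_pos]
    exact div_le_div₀ (sq_nonneg _) (one_le_pow₀ one_le) (by positivity) (by linarith)
  have weight_ge : sqrtWeight (R + 2) ≤ sqrtWeight y := not_lt.mp fun h =>
    (sqrtWeight_lt_iff.mp h).not_ge (abs_le_abs_of_nonneg (by linarith [hy.1]) hy.2)
  calc 1 / (2 * Real.sinh (R + 1)) * sqrtWeight (R + 2) / N * sqrtDensity x ^ 2
      ≤ 1 / (2 * Real.sinh (R + 1)) * sqrtWeight (R + 2) / N * (sqrtWeight x * N) := by
        rw [sqrtDensity_sq]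
        gcongr
        · exact (sqrtWeight_pos x).le
        · exact rate_mul_sqrtWeight_le x
    _ = 1 / (2 * Real.sinh (R + 1)) * sqrtWeight x * sqrtWeight (R + 2) := by field_simp
    _ ≤ jump x y := by
        have := (sqrtWeight_pos x).le
        have := convKernel_nonneg (y - x)
        unfold jump
        gcongr

theorem exists_local_poincare {R : ℝ} (hR : 0 < R) : ∃ c > 0, ∀ u : ℝ →₂[volume] ℝ, ∃ m : ℝ,
    c * ∫ x in Set.Icc (-R) R, (u x - m * sqrtDensity x) ^ 2 ≤ ⟪collisionOp u, u⟫ := by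
  obtain ⟨c, hc, le_jump⟩ := exists_mul_sqrtDensity_sq_le_jump hR
  have volume_eq : volume (Set.Icc (R + 1) (R + 2)) = 1 := by
    rw [Real.volume_Icc]
    norm_num
  refine ⟨c / 2, half_pos hc, fun u => ?_⟩
  obtain ⟨t, ht⟩ := exists_setIntegral_mul_sq_sub_le (J := jump)
    (g := fun x => u x / sqrtDensity x) (k := fun x => c * sqrtDensity x ^ 2)
    measurableSet_Icc measurableSet_Icc (volume_eq.trans_ne one_ne_zero)
    (volume_eq.trans_ne ENNReal.one_ne_top) jump_nonneg
    (fun x _ => mul_nonneg hc.le (sq_nonneg _)) le_jump (integrable_energy u)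
  refine ⟨u t / sqrtDensity t, ?_⟩
  have integrand (x : ℝ) :
      c * sqrtDensity x ^ 2 * (u x / sqrtDensity x - u t / sqrtDensity t) ^ 2
        = c * (u x - u t / sqrtDensity t * sqrtDensity x) ^ 2 := by
    have := (sqrtDensity_pos x).ne'
    rw [mul_assoc, ← mul_pow]
    field_simp
  simp_rw [integrand] at ht
  rw [integral_energy, Measure.real, volume_eq, ENNReal.toReal_one, one_mul,
    integral_const_mul] at ht
  linarith

theorem integrable_sq_div_rate (v : ℝ →₂[volume] ℝ) : Integrable fun x => v x ^ 2 / rate x := by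
  refine ((Lp.memLp v).integrable_sq.div_const rateMin).mono'
    (((Lp.aestronglyMeasurable v).aemeasurable.pow_const 2).div
      measurable_rate.aemeasurable).aestronglyMeasurable (Eventually.of_forall fun x => ?_)
  rw [Real.norm_of_nonneg (div_nonneg (sq_nonneg _) (rate_pos x).le)]
  exact div_le_div_of_nonneg_left (sq_nonneg _) rateMin_pos (rateMin_le x)

theorem inner_scatOp_zero_le (v : ℝ →₂[volume] ℝ) :
    ⟪scatOp 0 v, v⟫ ≤ (∫ z, convKernel z) * ∫ x, v x ^ 2 / rate x := by
  have conv : ConvDominated volume convKernel fun x y : ℝ => convKernel (y - x) :=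
    ⟨integrable_convKernel, by unfold Function.uncurry; fun_prop,
      fun x y => (abs_of_nonneg (convKernel_nonneg _)).le⟩
  have sq_eq (x : ℝ) : (v x / √(rate x)) ^ 2 = v x ^ 2 / rate x := by
    rw [div_pow, Real.sq_sqrt (rate_pos x).le]
  have memLp : MemLp (fun x => v x / √(rate x)) 2 := by
    refine (memLp_two_iff_integrable_sq ((Lp.aestronglyMeasurable v).aemeasurable.div
      measurable_rate.sqrt.aemeasurable).aestronglyMeasurable).mpr ?_
    exact (integrable_sq_div_rate v).congr (Eventually.of_forall fun x => (sq_eq x).symm)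
  have young := conv.integral_prod_self_le memLp
  simp only [sq_eq] at young
  rw [scatOp, ConvDominated.inner_op]
  refine (integral_congr_ae (Eventually.of_forall fun p => ?_)).trans_le young
  simp only [symKernel, pow_zero, one_mul]
  field_simp

/-- The scattering-in term is small at high energies, where the relaxation rate is large. -/
theorem exists_half_norm_sq_le : ∃ R > 0, ∃ C ≥ 0, ∀ v : ℝ →₂[volume] ℝ,
    ‖v‖ ^ 2 / 2 ≤ ⟪collisionOp v, v⟫ + C * ∫ x in Set.Icc (-R) R, v x ^ 2 := by
  set N := ∫ z, convKernel z
  have N_pos : 0 < N := integral_convKernel_pos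
  refine ⟨4 * N + 1, by positivity, N / rateMin, (div_pos N_pos rateMin_pos).le, fun v => ?_⟩
  set I := Set.Icc (-(4 * N + 1)) (4 * N + 1)
  have integrable := (Lp.memLp v).integrable_sq
  have indicator : Integrable (I.indicator fun x => v x ^ 2) :=
    integrable.indicator measurableSet_Icc
  have pointwise (x : ℝ) :
      N * (v x ^ 2 / rate x) ≤ v x ^ 2 / 2 + N / rateMin * I.indicator (fun x => v x ^ 2) x := by
    have sq_nonneg := sq_nonneg (v x)
    by_cases hx : x ∈ I
    · calc N * (v x ^ 2 / rate x) ≤ N * (v x ^ 2 / rateMin) := by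
            gcongr
            exacts [rateMin_pos, rateMin_le x]
        _ ≤ _ := by
            rw [Set.indicator_of_mem hx, mul_div_left_comm, mul_comm (N / rateMin)]
            linarith
    · have rate_ge : 2 * N ≤ rate x := by
        have : 4 * N + 1 < |x| := not_le.mp fun h => hx (abs_le.mp h)
        linarith [abs_sub_one_div_two_le_rate x]
      rw [Set.indicator_of_notMem hx, mul_zero, add_zero, mul_div_assoc',
        div_le_iff₀ (rate_pos x)]
      nlinarith
  have integrated := integral_mono ((integrable_sq_div_rate v).const_mul N)
    ((integrable.div_const 2).add (indicator.const_mul (N / rateMin))) pointwise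
  simp only [Pi.add_apply] at integrated
  rw [integral_const_mul, integral_add (integrable.div_const 2) (indicator.const_mul _),
    integral_div, integral_const_mul, integral_indicator measurableSet_Icc,
    ← norm_sq_eq_integral_sq] at integrated
  linarith [inner_scatOp_zero_le v, inner_collisionOp_self v]

theorem hasGapAbove_collisionOp : HasGapAbove collisionOp sqrtDensityLp := by
  obtain ⟨R, hR, C, hC, half_norm_sq_le⟩ := exists_half_norm_sq_le
  obtain ⟨c, hc, local_poincare⟩ := exists_local_poincare hR
  refine ⟨(2 * (1 + C / c))⁻¹, by positivity, fun u => ?_⟩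
  obtain ⟨m, hm⟩ := local_poincare u
  refine ⟨m, ?_⟩
  set v := u - m • sqrtDensityLp with hv
  have coeFn_v : v =ᵐ[volume] fun x => u x - m * sqrtDensity x := by
    filter_upwards [Lp.coeFn_sub u (m • sqrtDensityLp), Lp.coeFn_smul m sqrtDensityLp,
      coeFn_sqrtDensityLp] with x h_sub h_smul h_coe
    rw [hv, h_sub, Pi.sub_apply, h_smul, Pi.smul_apply, h_coe, smul_eq_mul]
  have local_le : ∫ x in Set.Icc (-R) R, v x ^ 2 ≤ ⟪collisionOp u, u⟫ / c := by
    rw [le_div_iff₀' hc]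
    refine le_of_eq_of_le (congrArg (c * ·) ?_) hm
    exact integral_congr_ae (ae_restrict_of_ae (coeFn_v.fun_comp (· ^ 2)))
  have := half_norm_sq_le v
  rw [inner_collisionOp_sub_smul] at this
  rw [inv_mul_le_iff₀ (by positivity)]
  linarith [mul_le_mul_of_nonneg_left local_le hC,
    (by ring : C * (⟪collisionOp u, u⟫ / c) = C / c * ⟪collisionOp u, u⟫)]

end SpectralGap

end ElectronPhonon

section WithDensity

variable {α : Type*} [MeasurableSpace α] {μ : Measure α} {g f : α → ℝ}

theorem eLpNorm_two_withDensity_sq (hg : Measurable g) :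
    eLpNorm f 2 (μ.withDensity fun x => ENNReal.ofReal (g x ^ 2))
      = eLpNorm (fun x => g x * f x) 2 μ := by
  have integrand (x : α) :
      ENNReal.ofReal (g x ^ 2) * ‖f x‖ₑ ^ (2 : ℝ) = ‖g x * f x‖ₑ ^ (2 : ℝ) := by
    rw [enorm_mul, ENNReal.mul_rpow_of_nonneg _ _ zero_le_two, Real.enorm_eq_ofReal_abs (g x),
      ENNReal.ofReal_rpow_of_nonneg (abs_nonneg _) zero_le_two, Real.rpow_two, sq_abs]
  simp_rw [eLpNorm_eq_lintegral_rpow_enorm_toReal two_ne_zero ENNReal.ofNat_ne_top,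
    ENNReal.toReal_ofNat]
  rw [lintegral_withDensity_eq_lintegral_mul_non_measurable _ (hg.pow_const 2).ennreal_ofReal
    (Eventually.of_forall fun _ => ENNReal.ofReal_lt_top)]
  simp only [Pi.mul_apply, integrand]

theorem aestronglyMeasurable_withDensity_sq_iff (hg : Measurable g) (hg_ne_zero : ∀ x, g x ≠ 0) :
    AEStronglyMeasurable f (μ.withDensity fun x => ENNReal.ofReal (g x ^ 2)) ↔
      AEStronglyMeasurable (fun x => g x * f x) μ := by
  constructor
  · intro h
    refine hg.aestronglyMeasurable.mul (h.mono_ac (withDensity_absolutelyContinuous'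
      (hg.pow_const 2).ennreal_ofReal.aemeasurable (Eventually.of_forall fun x => ?_)))
    have := hg_ne_zero x
    rw [Ne, ENNReal.ofReal_eq_zero, not_le]
    positivity
  · intro h
    refine AEStronglyMeasurable.mono_ac (withDensity_absolutelyContinuous _ _)
      ((h.aemeasurable.div hg.aemeasurable).aestronglyMeasurable.congr
        (Eventually.of_forall fun x => ?_))
    exact mul_div_cancel_left₀ _ (hg_ne_zero x)

theorem memLp_two_withDensity_sq_iff (hg : Measurable g) (hg_ne_zero : ∀ x, g x ≠ 0) :
    MemLp f 2 (μ.withDensity fun x => ENNReal.ofReal (g x ^ 2)) ↔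
      MemLp (fun x => g x * f x) 2 μ := by
  rw [MemLp, MemLp, aestronglyMeasurable_withDensity_sq_iff hg hg_ne_zero,
    eLpNorm_two_withDensity_sq hg]

end WithDensity

section Scaling

variable {T : ℝ}

theorem ae_comp_mul_left_iff (hT : T ≠ 0) {p : ℝ → Prop} :
    (∀ᵐ x, p (T * x)) ↔ ∀ᵐ x, p x := by
  rw [← (measurableEmbedding_mulLeft₀ hT).ae_map_iff, Real.map_volume_mul_left hT,
    Measure.ae_ennreal_smul_measure_iff (by simpa using hT)]

theorem memLp_comp_mul_left_iff (hT : T ≠ 0) {p : ENNReal} {f : ℝ → ℝ} :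
    MemLp (fun x => f (T * x)) p ↔ MemLp f p := by
  refine (measurableEmbedding_mulLeft₀ hT).memLp_map_measure_iff.symm.trans ?_
  have h : ENNReal.ofReal |T⁻¹| ≠ 0 := by simpa using hT
  rw [Real.map_volume_mul_left hT]
  refine ⟨fun hf => ?_, fun hf => hf.smul_measure ENNReal.ofReal_ne_top⟩
  have := hf.smul_measure (ENNReal.inv_ne_top.mpr h)
  rwa [smul_smul, ENNReal.inv_mul_cancel h ENNReal.ofReal_ne_top, one_smul] at this

theorem eLpNorm_two_eq_mul_eLpNorm_comp_mul_left (hT : 0 < T) (f : ℝ → ℝ) :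
    eLpNorm f 2 = ENNReal.ofReal √T * eLpNorm (fun x => f (T * x)) 2 := by
  conv_lhs => rw [← Real.smul_map_volume_mul_left hT.ne']
  rw [eLpNorm_smul_measure_of_ne_top ENNReal.ofNat_ne_top,
    (measurableEmbedding_mulLeft₀ hT.ne').eLpNorm_map_measure, abs_of_pos hT, smul_eq_mul,
    ENNReal.ofReal_rpow_of_pos hT, Real.sqrt_eq_rpow, ENNReal.toReal_div, ENNReal.toReal_one,
    ENNReal.toReal_ofNat, Function.comp_def]

end Scaling

namespace ElectronPhonon

section Sigma

variable {ω₀ T : ℝ}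

theorem Gamma0_eq (ω₀ : ℝ) (hT : 0 < T) (x : ℝ) :
    Gamma0 ω₀ T (T * x) = T ^ 3 / ω₀ ^ 2 * rate x := by
  have h := Measure.integral_comp_mul_left (fun u => Kbar0 ω₀ T (T * x) u) T
  simp_rw [Kbar0_eq ω₀ hT, integral_const_mul] at h
  rw [abs_of_pos (inv_pos.mpr hT), smul_eq_mul] at h
  rw [Gamma0, rate, ← mul_inv_cancel_left₀ hT.ne' (∫ u, _), ← h]
  ring

theorem sigma_eq (ω₀ : ℝ) (hT : 0 < T) :
    sigma ω₀ T = volume.withDensity fun ε =>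
      ENNReal.ofReal ((√(T ^ 3) / ω₀ * sqrtDensity (ε / T)) ^ 2) := by
  rw [sigma]
  congr with ε
  obtain ⟨x, rfl⟩ : ∃ x, T * x = ε := ⟨ε / T, mul_div_cancel₀ _ hT.ne'⟩
  rw [weight_eq, Gamma0_eq ω₀ hT, mul_div_cancel_left₀ _ hT.ne', mul_pow, sqrtDensity_sq, div_pow,
    Real.sq_sqrt (by positivity)]
  ring_nf

theorem measurable_sqrtDensity_div (c T : ℝ) : Measurable fun ε => c * sqrtDensity (ε / T) :=
  (measurable_sqrtDensity.comp (measurable_id.div_const T)).const_mul c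

theorem memLp_sigma_iff (hω₀ : 0 < ω₀) (hT : 0 < T) {φ : ℝ → ℝ} :
    MemLp φ 2 (sigma ω₀ T) ↔ MemLp (fun x => sqrtDensity x * φ (T * x)) 2 := by
  have hc : √(T ^ 3) / ω₀ ≠ 0 := by positivity
  rw [sigma_eq ω₀ hT, memLp_two_withDensity_sq_iff (measurable_sqrtDensity_div _ _)
    fun ε => mul_ne_zero hc (sqrtDensity_pos _).ne', ← memLp_comp_mul_left_iff hT.ne']
  simp_rw [mul_div_cancel_left₀ _ hT.ne', mul_assoc]
  refine ⟨fun h => ?_, fun h => h.const_mul _⟩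
  convert h.const_mul (√(T ^ 3) / ω₀)⁻¹ using 2 with x
  rw [inv_mul_cancel_left₀ hc]

theorem eLpNorm_sigma (hω₀ : 0 < ω₀) (hT : 0 < T) (φ : ℝ → ℝ) :
    eLpNorm φ 2 (sigma ω₀ T)
      = ENNReal.ofReal (T ^ 2 / ω₀) * eLpNorm (fun x => sqrtDensity x * φ (T * x)) 2 := by
  rw [sigma_eq ω₀ hT, eLpNorm_two_withDensity_sq (measurable_sqrtDensity_div _ _),
    eLpNorm_two_eq_mul_eLpNorm_comp_mul_left hT]
  simp_rw [mul_div_cancel_left₀ _ hT.ne', mul_assoc, ← smul_eq_mul (√(T ^ 3) / ω₀)]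
  have const_smul := eLpNorm_const_smul (√(T ^ 3) / ω₀) (fun x => sqrtDensity x * φ (T * x)) 2
    volume
  have sqrt_mul_sqrt : √T * (√(T ^ 3) / ω₀) = T ^ 2 / ω₀ := by
    rw [← mul_div_assoc, ← Real.sqrt_mul hT.le, (by ring : T * T ^ 3 = (T ^ 2) ^ 2),
      Real.sqrt_sq (by positivity)]
  rw [← sqrt_mul_sqrt, ENNReal.ofReal_mul (Real.sqrt_nonneg T), mul_assoc]
  rw [Real.enorm_of_nonneg (by positivity)] at const_smul
  exact congrArg (_ * ·) const_smul

end Sigma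

section Represents

/-- `u ∈ L²(ℝ)` represents the function `φ` of the energy at temperature `T`, under the
isometry (up to a constant factor) between `L²_σ` and the fixed space `L²(ℝ)`. -/
def Represents (T : ℝ) (u : ℝ →₂[volume] ℝ) (φ : ℝ → ℝ) : Prop :=
  u =ᵐ[volume] fun x => sqrtDensity x * φ (T * x)

namespace Represents

variable {ω₀ T : ℝ} {u v : ℝ →₂[volume] ℝ} {φ ψ : ℝ → ℝ}

theorem memLp_sigma (hω₀ : 0 < ω₀) (hT : 0 < T) (h : Represents T u φ) : MemLp φ 2 (sigma ω₀ T) :=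
  (memLp_sigma_iff hω₀ hT).mpr ((Lp.memLp u).ae_eq h)

theorem eLpNorm_sigma (hω₀ : 0 < ω₀) (hT : 0 < T) (h : Represents T u φ) :
    eLpNorm φ 2 (sigma ω₀ T) = ENNReal.ofReal (T ^ 2 / ω₀ * ‖u‖) := by
  rw [ElectronPhonon.eLpNorm_sigma hω₀ hT, ENNReal.ofReal_mul (by positivity), ofReal_norm,
    Lp.enorm_def, eLpNorm_congr_ae h]

theorem ae_eq_iff (hT : T ≠ 0) (hu : Represents T u φ) (hv : Represents T v ψ) :
    φ =ᵐ[volume] ψ ↔ u = v := by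
  rw [Lp.ext_iff, EventuallyEq, ← ae_comp_mul_left_iff hT]
  refine eventually_congr ?_
  filter_upwards [hu, hv] with x hux hvx
  rw [hux, hvx, mul_right_inj' (sqrtDensity_pos x).ne']

theorem add (hu : Represents T u φ) (hv : Represents T v ψ) :
    Represents T (u + v) fun ε => φ ε + ψ ε := by
  filter_upwards [hu, hv, Lp.coeFn_add u v] with x hux hvx h_add
  rw [h_add, Pi.add_apply, hux, hvx, mul_add]

theorem sub (hu : Represents T u φ) (hv : Represents T v ψ) :
    Represents T (u - v) fun ε => φ ε - ψ ε := by
  filter_upwards [hu, hv, Lp.coeFn_sub u v] with x hux hvx h_sub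
  rw [h_sub, Pi.sub_apply, hux, hvx, mul_sub]

theorem const_smul (c : ℝ) (h : Represents T u φ) : Represents T (c • u) fun ε => c * φ ε := by
  filter_upwards [h, Lp.coeFn_smul c u] with x hx h_smul
  rw [h_smul, Pi.smul_apply, hx, smul_eq_mul, mul_left_comm]

theorem comp_div (hT : T ≠ 0) (h : Represents 1 u φ) : Represents T u fun ε => φ (ε / T) := by
  filter_upwards [h] with x hx
  rw [hx, one_mul, mul_div_cancel_left₀ _ hT]

theorem comp_neg (h : Represents T u φ) :
    Represents T (reflection volume u) fun ε => φ (-ε) := by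
  filter_upwards [coeFn_reflection u, ae_neg h] with x h_refl hx
  rw [h_refl, hx, sqrtDensity_neg, mul_neg]

theorem evenPart (h : Represents T u φ) :
    Represents T ((2⁻¹ : ℝ) • (u + reflection volume u)) (evenPart φ) := by
  convert (h.add h.comp_neg).const_smul 2⁻¹ using 2 with ε
  exact div_eq_inv_mul _ _

theorem oddPart (h : Represents T u φ) :
    Represents T ((2⁻¹ : ℝ) • (u - reflection volume u)) (oddPart φ) := by
  convert (h.sub h.comp_neg).const_smul 2⁻¹ using 2 with ε
  exact div_eq_inv_mul _ _

end Represents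

variable {ω₀ T : ℝ}

theorem represents_one (T : ℝ) : Represents T sqrtDensityLp fun _ => 1 := by
  filter_upwards [coeFn_sqrtDensityLp] with x hx
  rw [hx, mul_one]

theorem exists_represents_of_memLp (hω₀ : 0 < ω₀) (hT : 0 < T) {φ : ℝ → ℝ}
    (h : MemLp φ 2 (sigma ω₀ T)) : ∃ u, Represents T u φ :=
  ⟨_, ((memLp_sigma_iff hω₀ hT).mp h).coeFn_toLp⟩

theorem exists_represents (hT : T ≠ 0) (u : ℝ →₂[volume] ℝ) : ∃ φ, Represents T u φ := by
  refine ⟨fun ε => u (ε / T) / sqrtDensity (ε / T), Eventually.of_forall fun x => ?_⟩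
  simp only [mul_div_cancel_left₀ _ hT]
  exact (mul_div_cancel₀ _ (sqrtDensity_pos x).ne').symm

end Represents

open RealInnerProductSpace

section IntegralEquation

variable {ω₀ εF T : ℝ}

/-- The operator of the first-order correction `K̄₁` in the temperature. -/
noncomputable def firstOrderOp (εF : ℝ) : (ℝ →₂[volume] ℝ) →L[ℝ] ℝ →₂[volume] ℝ :=
  (1 / (2 * εF)) • scatOp 1

/-- The operator of the second-order correction `K̄₂` in the temperature. -/
noncomputable def secondOrderOp (ω₀ : ℝ) : (ℝ →₂[volume] ℝ) →L[ℝ] ℝ →₂[volume] ℝ :=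
  (1 / (2 * ω₀ ^ 2)) • scatOp 2

theorem inner_firstOrderOp_comm (εF : ℝ) (u v : ℝ →₂[volume] ℝ) :
    ⟪firstOrderOp εF u, v⟫ = -⟪u, firstOrderOp εF v⟫ := by
  simp only [firstOrderOp, _root_.smul_apply, real_inner_smul_left, inner_smul_right,
    inner_scatOp_comm 1 u v]
  ring

theorem inner_firstOrderOp_self (εF : ℝ) (u : ℝ →₂[volume] ℝ) : ⟪firstOrderOp εF u, u⟫ = 0 :=
  inner_self_eq_zero_of_skew (inner_firstOrderOp_comm εF) u

theorem firstOrderOp_sqrtDensityLp_ne_zero (hεF : εF ≠ 0) : firstOrderOp εF sqrtDensityLp ≠ 0 := by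
  have h : 1 / (2 * εF) ≠ 0 := by positivity
  exact smul_ne_zero h scatOp_one_sqrtDensityLp_ne_zero

theorem reflection_firstOrderOp (εF : ℝ) (u : ℝ →₂[volume] ℝ) :
    reflection volume (firstOrderOp εF u) = -firstOrderOp εF (reflection volume u) := by
  simp only [firstOrderOp, _root_.smul_apply, map_smul, reflection_scatOp, pow_one, neg_smul,
    one_smul, smul_neg]

theorem inner_secondOrderOp_sqrtDensityLp_pos (hω₀ : ω₀ ≠ 0) :
    0 < ⟪secondOrderOp ω₀ sqrtDensityLp, sqrtDensityLp⟫ := by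
  rw [secondOrderOp, _root_.smul_apply, real_inner_smul_left]
  exact mul_pos (by positivity) inner_scatOp_two_sqrtDensityLp_pos

/-- The kernel `K` in dimensionless variables, transported to `L²(ℝ)`. -/
noncomputable def rescaledK (ω₀ εF T x y : ℝ) : ℝ :=
  symKernel 0 x y + T * (1 / (2 * εF)) * symKernel 1 x y
    - T ^ 2 * (1 / (2 * ω₀ ^ 2)) * symKernel 2 x y

theorem sqrtDensity_mul_K (hω₀ : ω₀ ≠ 0) (hT : 0 < T) (x y : ℝ) :
    sqrtDensity x * K ω₀ εF T (T * x) (T * y)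
      = T⁻¹ * (rescaledK ω₀ εF T x y * sqrtDensity y) := by
  have scale : (T * y - T * x) / T = y - x := by field_simp
  have sq_sqrt : rate x = √(rate x) ^ 2 := (Real.sq_sqrt (rate_pos x).le).symm
  have := (sqrtWeight_pos x).ne'
  have := (sqrt_rate_pos x).ne'
  have := (sqrt_rate_pos y).ne'
  have first : Kbar1 ω₀ εF T (T * x) (T * y)
      = T * (1 / (2 * εF)) * (y - x) * Kbar0 ω₀ T (T * x) (T * y) := by
    rw [Kbar1, scale, ← div_mul_cancel₀ (1 : ℝ) hω₀]
    field_simp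
  rw [K, first, Kbar2, Gamma0_eq ω₀ hT, Kbar0_eq ω₀ hT, scale, sq_sqrt, sqrtDensity, sqrtDensity,
    rescaledK, symKernel, symKernel, symKernel]
  generalize 1 / (2 * εF) = a
  field_simp

theorem ae_integral_rescaledK_mul (ω₀ εF T : ℝ) (u : ℝ →₂[volume] ℝ) :
    ∀ᵐ x, Integrable (fun y => rescaledK ω₀ εF T x y * u y) ∧
      ∫ y, rescaledK ω₀ εF T x y * u y
        = (u - quadraticPencil collisionOp (firstOrderOp εF) (secondOrderOp ω₀) T u) x := by
  have expand : u - quadraticPencil collisionOp (firstOrderOp εF) (secondOrderOp ω₀) T u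
      = scatOp 0 u + (T * (1 / (2 * εF))) • scatOp 1 u
        - (T ^ 2 * (1 / (2 * ω₀ ^ 2))) • scatOp 2 u := by
    rw [quadraticPencil_apply, collisionOp_apply, firstOrderOp, secondOrderOp]
    simp only [_root_.smul_apply, smul_smul]
    abel
  have integrable (j : ℕ) : ∀ᵐ x, Integrable fun y => symKernel j x y * u y :=
    ((convDominated_symKernel j).ae_integrable_and_sq_le (Lp.memLp u)).mono fun _ h => h.1
  have coeFn (j : ℕ) : scatOp j u =ᵐ[volume] fun x => ∫ y, symKernel j x y * u y :=
    (convDominated_symKernel j).coeFn_op u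
  filter_upwards [integrable 0, integrable 1, integrable 2, coeFn 0, coeFn 1, coeFn 2,
    Lp.coeFn_sub (scatOp 0 u + (T * (1 / (2 * εF))) • scatOp 1 u)
      ((T ^ 2 * (1 / (2 * ω₀ ^ 2))) • scatOp 2 u),
    Lp.coeFn_add (scatOp 0 u) ((T * (1 / (2 * εF))) • scatOp 1 u),
    Lp.coeFn_smul (T * (1 / (2 * εF))) (scatOp 1 u),
    Lp.coeFn_smul (T ^ 2 * (1 / (2 * ω₀ ^ 2))) (scatOp 2 u)]
    with x int0 int1 int2 coe0 coe1 coe2 h_sub h_add h_smul1 h_smul2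
  have int01 := int0.fun_add (int1.const_mul (T * (1 / (2 * εF))))
  have int2' := int2.const_mul (T ^ 2 * (1 / (2 * ω₀ ^ 2)))
  simp only [rescaledK, sub_mul, add_mul, mul_assoc (_ * _) (symKernel _ _ _)]
  refine ⟨int01.sub int2', ?_⟩
  rw [expand, h_sub, Pi.sub_apply, h_add, Pi.add_apply, h_smul1, h_smul2, Pi.smul_apply,
    Pi.smul_apply, coe0, coe1, coe2, integral_sub int01 int2',
    integral_add int0 (int1.const_mul _), integral_const_mul, integral_const_mul, smul_eq_mul,
    smul_eq_mul]

variable {u : ℝ →₂[volume] ℝ} {φ : ℝ → ℝ}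

theorem Represents.sqrtDensity_mul_K_mul (hω₀ : ω₀ ≠ 0) (hT : 0 < T) (hu : Represents T u φ)
    (x : ℝ) :
    (fun y => sqrtDensity x * (K ω₀ εF T (T * x) (T * y) * φ (T * y))) =ᵐ[volume]
      fun y => T⁻¹ * (rescaledK ω₀ εF T x y * u y) := by
  filter_upwards [hu] with y hy
  rw [hy, ← mul_assoc, sqrtDensity_mul_K hω₀ hT]
  ring

theorem Represents.ae_integrable_K_mul (hω₀ : ω₀ ≠ 0) (hT : 0 < T) (hu : Represents T u φ) :
    ∀ᵐ ε, Integrable fun v => K ω₀ εF T ε v * φ v := by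
  rw [← ae_comp_mul_left_iff hT.ne']
  filter_upwards [ae_integral_rescaledK_mul ω₀ εF T u] with x hx
  rw [← integrable_comp_mul_left_iff _ hT.ne',
    ← integrable_const_mul_iff (sqrtDensity_pos x).ne'.isUnit]
  exact (hx.1.const_mul _).congr (hu.sqrtDensity_mul_K_mul hω₀ hT x).symm

theorem Represents.integral_K_mul (hω₀ : ω₀ ≠ 0) (hT : 0 < T) (hu : Represents T u φ) :
    Represents T (u - quadraticPencil collisionOp (firstOrderOp εF) (secondOrderOp ω₀) T u)
      fun ε => ∫ v, K ω₀ εF T ε v * φ v := by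
  filter_upwards [ae_integral_rescaledK_mul ω₀ εF T u] with x hx
  have change_variable :=
    Measure.integral_comp_mul_left (fun v => K ω₀ εF T (T * x) v * φ v) T
  have integral_eq := integral_congr_ae (hu.sqrtDensity_mul_K_mul (εF := εF) hω₀ hT x)
  rw [integral_const_mul, integral_const_mul, change_variable, abs_of_pos (inv_pos.mpr hT),
    smul_eq_mul, mul_left_comm] at integral_eq
  rw [← hx.2, mul_left_cancel₀ (inv_ne_zero hT.ne') integral_eq]

theorem represents_inv_Gamma0 (ω₀ : ℝ) (hT : 0 < T) :
    Represents T ((ω₀ ^ 2 / T ^ 3) • sourceLp) fun ε => 1 / Gamma0 ω₀ T ε := by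
  filter_upwards [coeFn_sourceLp, Lp.coeFn_smul (ω₀ ^ 2 / T ^ 3) sourceLp] with x h_source h_smul
  have sqrt_div : √(rate x) / rate x = 1 / √(rate x) := Real.sqrt_div_self'
  rw [h_smul, Pi.smul_apply, h_source, Gamma0_eq ω₀ hT, sqrtDensity, source, smul_eq_mul,
    one_div, mul_inv, inv_div, ← mul_one_div (sqrtWeight x), ← sqrt_div]
  ring

theorem isSolution_iff (hω₀ : 0 < ω₀) (hT : 0 < T) (hu : Represents T u φ) :
    IsSolution ω₀ εF T φ ↔
      quadraticPencil collisionOp (firstOrderOp εF) (secondOrderOp ω₀) T u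
        = (ω₀ ^ 2 / T ^ 3) • sourceLp := by
  have equation_iff : (∀ᵐ ε, φ ε = 1 / Gamma0 ω₀ T ε + ∫ v, K ω₀ εF T ε v * φ v) ↔
      u = (ω₀ ^ 2 / T ^ 3) • sourceLp
        + (u - quadraticPencil collisionOp (firstOrderOp εF) (secondOrderOp ω₀) T u) :=
    hu.ae_eq_iff hT.ne' ((represents_inv_Gamma0 ω₀ hT).add (hu.integral_K_mul hω₀.ne' hT))
  rw [← sub_eq_iff_eq_add, sub_sub_cancel] at equation_iff
  rw [← equation_iff]
  exact ⟨IsSolution.equation,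
    fun h => ⟨hu.memLp_sigma hω₀ hT, hu.ae_integrable_K_mul hω₀.ne' hT, h⟩⟩

end IntegralEquation

end ElectronPhonon

theorem le_of_tendsto_rpow_smul {E : Type*} [NormedAddCommGroup E] [NormedSpace ℝ E] {F : ℝ → E}
    {n m : ℝ} {X Y : E} (hY : Y ≠ 0)
    (hn : Tendsto (fun t : ℝ => t ^ (-n) • F t) (𝓝[>] 0) (𝓝 X))
    (hm : Tendsto (fun t : ℝ => t ^ (-m) • F t) (𝓝[>] 0) (𝓝 Y)) : n ≤ m := by
  by_contra! hlt
  have rpow_tendsto : Tendsto (fun t : ℝ => t ^ (n - m)) (𝓝[>] 0) (𝓝 0) := by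
    have h := (Real.continuousAt_rpow_const 0 (n - m) (Or.inr (sub_pos.mpr hlt).le)).tendsto
    rw [Real.zero_rpow (sub_pos.mpr hlt).ne'] at h
    exact h.mono_left nhdsWithin_le_nhds
  have smul_tendsto := rpow_tendsto.smul hn
  rw [zero_smul] at smul_tendsto
  refine hY (tendsto_nhds_unique (hm.congr' ?_) smul_tendsto)
  filter_upwards [self_mem_nhdsWithin] with t (ht : 0 < t)
  rw [smul_smul, ← Real.rpow_add ht, add_comm, add_sub, neg_add_cancel, zero_sub]

theorem tendsto_ofReal_norm_sub_div_norm_iff {ι E : Type*} [NormedAddCommGroup E] {g : ι → E}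
    {l : Filter ι} {X : E} (hX : X ≠ 0) :
    Tendsto (fun i => ENNReal.ofReal (‖g i - X‖ / ‖X‖)) l (𝓝 0) ↔ Tendsto g l (𝓝 X) := by
  have h := tendsto_const_smul_iff₀ (f := fun i => ‖g i - X‖) (l := l) (a := 0)
    (inv_ne_zero (norm_ne_zero_iff.mpr hX))
  rw [smul_zero] at h
  rw [← ENNReal.tendsto_toReal_zero_iff fun _ => ENNReal.ofReal_ne_top,
    tendsto_iff_norm_sub_tendsto_zero (f := g), ← h]
  refine tendsto_congr fun i => ?_
  rw [ENNReal.toReal_ofReal (by positivity), smul_eq_mul, div_eq_inv_mul]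

namespace ElectronPhonon

open RealInnerProductSpace

section LeadingTerm

variable {ω₀ : ℝ} {f : ℝ → ℝ → ℝ} {n m : ℝ} {Φ Ψ : ℝ → ℝ} {F : ℝ → ℝ →₂[volume] ℝ}
  {X : ℝ →₂[volume] ℝ}

theorem Represents.rpow_mul_comp_div {T : ℝ} (hT : 0 < T) (n : ℝ) (hX : Represents 1 X Φ) :
    Represents T (T ^ n • X) fun ε => T ^ n * Φ (ε / T) :=
  (hX.comp_div hT.ne').const_smul _

theorem Represents.eLpNorm_sub_div_eLpNorm {T : ℝ} {u : ℝ →₂[volume] ℝ} {φ : ℝ → ℝ}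
    (hω₀ : 0 < ω₀) (hT : 0 < T) (hu : Represents T u φ) (hX : Represents 1 X Φ) (hX0 : X ≠ 0) :
    eLpNorm (fun ε => φ ε - T ^ n * Φ (ε / T)) 2 (sigma ω₀ T) /
        eLpNorm (fun ε => T ^ n * Φ (ε / T)) 2 (sigma ω₀ T)
      = ENNReal.ofReal (‖T ^ (-n) • u - X‖ / ‖X‖) := by
  have hX' := hX.rpow_mul_comp_div hT n
  have hTn : 0 < T ^ n := Real.rpow_pos_of_pos hT n
  have sub_eq : u - T ^ n • X = T ^ n • (T ^ (-n) • u - X) := by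
    rw [smul_sub, Real.rpow_neg hT.le, smul_inv_smul₀ hTn.ne']
  have := norm_pos_iff.mpr hX0
  rw [(hu.sub hX').eLpNorm_sigma hω₀ hT, hX'.eLpNorm_sigma hω₀ hT, sub_eq, norm_smul, norm_smul,
    Real.norm_of_nonneg hTn.le, ← ENNReal.ofReal_div_of_pos (by positivity),
    mul_div_mul_left _ _ (by positivity), mul_div_mul_left _ _ hTn.ne']

theorem hasLeadingTerm_iff (hω₀ : 0 < ω₀) (hF : ∀ᶠ T in 𝓝[>] (0 : ℝ), Represents T (F T) (f T))
    (hX : Represents 1 X Φ) :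
    HasLeadingTerm ω₀ f n Φ ↔
      X ≠ 0 ∧ Tendsto (fun T : ℝ => T ^ (-n) • F T) (𝓝[>] 0) (𝓝 X) := by
  have not_null_iff : ¬ Φ =ᵐ[volume] 0 ↔ X ≠ 0 := by
    have represents_zero : Represents 1 0 fun _ => 0 := by
      simpa only [zero_smul, zero_mul] using (represents_one 1).const_smul 0
    exact (hX.ae_eq_iff one_ne_zero represents_zero).not
  have tendsto_iff (hX0 : X ≠ 0) : Tendsto (fun T : ℝ =>
      eLpNorm (fun ε => f T ε - T ^ n * Φ (ε / T)) 2 (sigma ω₀ T) /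
        eLpNorm (fun ε => T ^ n * Φ (ε / T)) 2 (sigma ω₀ T)) (𝓝[>] 0) (𝓝 0) ↔
      Tendsto (fun T : ℝ => T ^ (-n) • F T) (𝓝[>] 0) (𝓝 X) := by
    rw [← tendsto_ofReal_norm_sub_div_norm_iff hX0]
    refine tendsto_congr' ?_
    filter_upwards [hF, self_mem_nhdsWithin] with T hFT hT
    exact hFT.eLpNorm_sub_div_eLpNorm hω₀ hT hX hX0
  constructor
  · intro h
    have hX0 := not_null_iff.mp h.not_null
    exact ⟨hX0, (tendsto_iff hX0).mp h.tendsto⟩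
  · rintro ⟨hX0, h⟩
    exact ⟨fun T hT => (hX.rpow_mul_comp_div hT n).memLp_sigma hω₀ hT, not_null_iff.mpr hX0,
      (tendsto_iff hX0).mpr h⟩

theorem HasLeadingTerm.exists_represents (hω₀ : 0 < ω₀) (h : HasLeadingTerm ω₀ f n Φ) :
    ∃ X, Represents 1 X Φ := by
  have memLp := h.memLp 1 one_pos
  simp only [Real.one_rpow, one_mul, div_one] at memLp
  exact exists_represents_of_memLp hω₀ one_pos memLp

theorem HasLeadingTerm.unique (hω₀ : 0 < ω₀)
    (hF : ∀ᶠ T in 𝓝[>] (0 : ℝ), Represents T (F T) (f T))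
    (hΦ : HasLeadingTerm ω₀ f n Φ) (hΨ : HasLeadingTerm ω₀ f m Ψ) : n = m ∧ Φ =ᵐ[volume] Ψ := by
  obtain ⟨X, hX⟩ := hΦ.exists_represents hω₀
  obtain ⟨Y, hY⟩ := hΨ.exists_represents hω₀
  obtain ⟨hX0, hX_lim⟩ := (hasLeadingTerm_iff hω₀ hF hX).mp hΦ
  obtain ⟨hY0, hY_lim⟩ := (hasLeadingTerm_iff hω₀ hF hY).mp hΨ
  obtain rfl : n = m := le_antisymm (le_of_tendsto_rpow_smul hY0 hX_lim hY_lim)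
    (le_of_tendsto_rpow_smul hX0 hY_lim hX_lim)
  exact ⟨rfl, (hX.ae_eq_iff one_ne_zero hY).mpr (tendsto_nhds_unique hX_lim hY_lim)⟩

end LeadingTerm

section LowTemperature

variable {ω₀ εF : ℝ}

theorem eventually_exists_unique_solution (hω₀ : 0 < ω₀) :
    ∀ᶠ T in 𝓝[>] (0 : ℝ), ∃ φ, IsSolution ω₀ εF T φ ∧
      ∀ ψ, IsSolution ω₀ εF T ψ → ψ =ᵐ[volume] φ := by
  filter_upwards [self_mem_nhdsWithin,
    hasGapAbove_collisionOp.eventually_bijective (inner_firstOrderOp_self εF)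
      (inner_secondOrderOp_sqrtDensityLp_pos hω₀.ne')] with T (hT : 0 < T) bijective
  obtain ⟨u, hu⟩ := bijective.surjective ((ω₀ ^ 2 / T ^ 3) • sourceLp)
  obtain ⟨φ, hφ⟩ := exists_represents hT.ne' u
  refine ⟨φ, (isSolution_iff hω₀ hT hφ).mpr hu, fun ψ hψ => ?_⟩
  obtain ⟨v, hv⟩ := exists_represents_of_memLp hω₀ hT hψ.memLp
  exact (hv.ae_eq_iff hT.ne' hφ).mpr
    (bijective.injective (((isSolution_iff hω₀ hT hv).mp hψ).trans hu.symm))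

theorem exists_represents_solution (hω₀ : 0 < ω₀) {φ : ℝ → ℝ → ℝ}
    (hφ : ∀ᶠ T in 𝓝[>] (0 : ℝ), IsSolution ω₀ εF T (φ T)) :
    ∃ F : ℝ → ℝ →₂[volume] ℝ, ∀ᶠ T in 𝓝[>] (0 : ℝ), Represents T (F T) (φ T) := by
  have exists_represents : ∀ᶠ T in 𝓝[>] (0 : ℝ), ∃ u, Represents T u (φ T) := by
    filter_upwards [hφ, self_mem_nhdsWithin] with T hφT hT
    exact exists_represents_of_memLp hω₀ hT hφT.memLp
  exact exists_represents.choice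

theorem eventually_quadraticPencil_eq (hω₀ : 0 < ω₀) {φ : ℝ → ℝ → ℝ} {F : ℝ → ℝ →₂[volume] ℝ}
    (hφ : ∀ᶠ T in 𝓝[>] (0 : ℝ), IsSolution ω₀ εF T (φ T))
    (hF : ∀ᶠ T in 𝓝[>] (0 : ℝ), Represents T (F T) (φ T)) :
    ∀ᶠ T in 𝓝[>] (0 : ℝ),
      quadraticPencil collisionOp (firstOrderOp εF) (secondOrderOp ω₀) T (T ^ 5 • F T)
        = T ^ 2 • ω₀ ^ 2 • sourceLp := by
  filter_upwards [hφ, hF, self_mem_nhdsWithin] with T hφT hFT (hT : 0 < T)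
  rw [map_smul, (isSolution_iff hω₀ hT hFT).mp hφT, smul_smul, smul_smul]
  congr 1
  field_simp

theorem exists_leading_terms (hω₀ : 0 < ω₀) (hεF : εF ≠ 0) :
    ∃ (c : ℝ) (χ : ℝ → ℝ), ∀ φ : ℝ → ℝ → ℝ,
      (∀ᶠ T in 𝓝[>] (0 : ℝ), IsSolution ω₀ εF T (φ T)) →
        HasLeadingTerm ω₀ (fun T => evenPart (φ T)) (-5) (fun _ => c) ∧
        HasLeadingTerm ω₀ (fun T => oddPart (φ T)) (-4) χ := by
  obtain ⟨c, X, hc, hX, h_lim⟩ := hasGapAbove_collisionOp.exists_tendsto inner_collisionOp_comm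
    collisionOp_sqrtDensityLp (inner_firstOrderOp_comm εF)
    (firstOrderOp_sqrtDensityLp_ne_zero hεF) (inner_secondOrderOp_sqrtDensityLp_pos hω₀.ne')
    (b := ω₀ ^ 2 • sourceLp)
    (by simp [inner_smul_right, hω₀.ne', inner_sqrtDensityLp_sourceLp_pos.ne'])
    (reflection volume) reflection_sqrtDensityLp reflection_collisionOp
    (reflection_firstOrderOp εF)
  obtain ⟨χ, hχ⟩ := exists_represents one_ne_zero X
  refine ⟨c, χ, fun φ hφ => ?_⟩
  obtain ⟨F, hF⟩ := exists_represents_solution hω₀ hφ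
  obtain ⟨even_lim, odd_lim⟩ := h_lim _ (eventually_quadraticPencil_eq hω₀ hφ hF)
  have hc_repr : Represents 1 (c • sqrtDensityLp) fun _ => c := by
    simpa only [mul_one] using (represents_one 1).const_smul c
  constructor
  · refine (hasLeadingTerm_iff hω₀ (hF.mono fun T h => h.evenPart) hc_repr).mpr ⟨?_, ?_⟩
    · refine smul_ne_zero hc fun h => ?_
      exact inner_sqrtDensityLp_sourceLp_pos.ne' (by rw [h, inner_zero_left])
    · refine even_lim.congr fun T => ?_
      rw [map_smul, ← smul_add, smul_comm, neg_neg, Real.rpow_ofNat]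
  · refine (hasLeadingTerm_iff hω₀ (hF.mono fun T h => h.oddPart) hχ).mpr ⟨hX, ?_⟩
    refine odd_lim.congr' ?_
    filter_upwards [self_mem_nhdsWithin] with T (hT : 0 < T)
    rw [map_smul, ← smul_sub, smul_comm _ (T ^ 5), smul_smul, neg_neg, Real.rpow_ofNat,
      pow_succ' T 4, inv_mul_cancel_left₀ hT.ne']

end LowTemperature

end ElectronPhonon

theorem lemma3p3 (ω₀ εF : ℝ) (hω₀ : 0 < ω₀) (hεF : 0 < εF) :
    -- at low temperature the integral equation has exactly one solution
    (∃ T₀ : ℝ, 0 < T₀ ∧ ∀ T : ℝ, 0 < T → T < T₀ →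
      ∃ φ : ℝ → ℝ, ElectronPhonon.IsSolution ω₀ εF T φ ∧
        ∀ ψ : ℝ → ℝ, ElectronPhonon.IsSolution ω₀ εF T ψ → ψ =ᵐ[volume] φ) ∧
    ∃ (c : ℝ) (χ : ℝ → ℝ), ∀ φ : ℝ → ℝ → ℝ,
      (∀ᶠ T in 𝓝[>] (0 : ℝ), ElectronPhonon.IsSolution ω₀ εF T (φ T)) →
        -- the leading contribution to the even part is the constant function `c T⁻⁵`
        ElectronPhonon.HasLeadingTerm ω₀ (fun T => ElectronPhonon.evenPart (φ T)) (-5)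
          (fun _ => c) ∧
        -- the leading contribution to the odd part is `T⁻⁴ χ(ε/T)`
        ElectronPhonon.HasLeadingTerm ω₀ (fun T => ElectronPhonon.oddPart (φ T)) (-4) χ ∧
        -- and these exponents and the constancy are forced
        ∀ (np nm : ℝ) (Φp Φm : ℝ → ℝ),
          ElectronPhonon.HasLeadingTerm ω₀ (fun T => ElectronPhonon.evenPart (φ T)) (-np) Φp →
          ElectronPhonon.HasLeadingTerm ω₀ (fun T => ElectronPhonon.oddPart (φ T)) (-nm) Φm →
            np = nm + 1 ∧ np = 5 ∧ Φp =ᵐ[volume] fun _ => c := by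
  obtain ⟨T₀, hT₀, unique_solution⟩ := mem_nhdsGT_iff_exists_Ioo_subset.mp
    (ElectronPhonon.eventually_exists_unique_solution (εF := εF) hω₀)
  obtain ⟨c, χ, leading_terms⟩ := ElectronPhonon.exists_leading_terms hω₀ hεF.ne'
  refine ⟨⟨T₀, hT₀, fun T hT hTT₀ => unique_solution ⟨hT, hTT₀⟩⟩, c, χ, fun φ hφ => ?_⟩
  obtain ⟨even_term, odd_term⟩ := leading_terms φ hφ
  refine ⟨even_term, odd_term, fun np nm Φp Φm hp hm => ?_⟩
  obtain ⟨F, hF⟩ := ElectronPhonon.exists_represents_solution hω₀ hφ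
  obtain ⟨hnp, hΦp⟩ := hp.unique hω₀ (hF.mono fun T h => h.evenPart) even_term
  obtain ⟨hnm, -⟩ := hm.unique hω₀ (hF.mono fun T h => h.oddPart) odd_term
  exact ⟨by linarith, by linarith, hΦp⟩
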